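/- **Setting.** Let $\mu,\gamma>0$. An episode has a random length $E\sim\mathrm{Exp}(\gamma)$; independently of it, second-price auctions arrive according to a Poisson process of rate $\mu$, at times $\theta_1<\theta_2<\cdots$. Their prices-to-beat $b_i^-\ge 0$ are i.i.d. with cumulative distribution function $q$, independent of $E$ and of the arrivals (if $\lim_{b\to\infty} q(b)<1$, the missing mass is that of a price $+\infty$, which is never beaten). A policy is a measurable function $\pi:[0,\infty)\to[0,\infty)$: at an auction taking place when the time elapsed since the last win (the *age*) is $\tau$, the bid is $\pi(\tau)$, and the auction is won if $\pi(\tau)>b_i^-$; a win resets the age to $0$. The payoff of an episode is $$\sum_{i:\ \theta_i\le E}\bigl(k(\tau_i)+\varepsilon_i-b_i^-\bigr)\,\mathbf 1[\pi(\tau_i)>b_i^-],$$ where $\tau_i$ is the age at the $i$-th auction and the noises $\varepsilon_i$ are independent given the ages, centred and sub-Gaussian (with a common variance factor). Let $\mathcal U(k,q,\pi,t)$ be its expectation when the age at the beginning of the episode is $t\ge 0$. Fix breakpoints $0=t_0<\dots<t_m$ and $0=b_0<\dots<b_n$. Let $\mathcal K$ be the set of continuous piecewise linear, concave, nondecreasing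 functions $k$ on $[0,\infty)$ with breakpoints among the $t_i$ which are constant on $[t_m,\infty)$. Let $\mathcal Q$ be the set of continuous piecewise linear, nondecreasing functions $q:[0,\infty)\to[0,1]$ with $q(0)=0$ and breakpoints among the $b_i$. Let $V^\star_{k,q}(\tau)=\sup_\pi\,\mathcal U(k,q,\pi,\tau)$ be the Bellman value, let $\mathcal S(k,q)(\tau)=\max\bigl(0,\;k(\tau)+V^\star_{k,q}(0)-V^\star_{k,q}(\tau)\bigr)$ be the policy returned by the solver, and for a policy $\pi$ let $\beta(\pi)=\lim_{t\to\infty}\pi(t)$. **Theorem (Extension invariance).** Let $k\in\mathcal K$ and $\hat q,\tilde q\in\mathcal Q$. 1. All policies have integrable payoffs in the environments $(k,\hat q)$ and $(k,\tilde q)$, from every initial age. The policies $\mathcal S(k,\hat q)$ and $\mathcal S(k,\tilde q)$ are optimal among all policies in the environments $(k,\hat q)$ and $(k,\tilde q)$ respectively, from every initial age. 2. The limit $\beta(\mathcal S(k,\hat q))$ exists, is finite, and $\mathcal S(k,\hat q)(\tau)\le\beta(\mathcal S(k,\hat q))$ for all $\tau\ge0$. 3. If $\tilde q(b)=\hat q(b)$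 for all $b\in[0,\beta(\mathcal S(k,\hat q))]$, then $$\mathcal U(k,\hat q,\mathcal S(k,\hat q),0)=\mathcal U(k,\tilde q,\mathcal S(k,\tilde q),0),$$ and moreover $\mathcal S(k,\hat q)=\mathcal S(k,\tilde q)$ on $[0,\infty)$; so $q$ only needs to be known up to the maximal optimal bid. -/

import Mathlib

open MeasureTheory ProbabilityTheory Filter Topology Set
open scoped NNReal ENNReal

noncomputable section

namespace DynamicBidding

/-! ### Primitives -/

/-- The fixed (known) parameters of the environment: the rate `arrivalRate` of the Poisson process
of auctions, the rate `endRate` of the exponential lifetime of an episode, and the reward noise.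
The noise of an auction won at age `τ` is `noise τ ξ`, where `ξ` is a fresh random seed of law
`seedLaw`; so the noises are independent given the ages, each being centred and sub-Gaussian.
(I.i.d. noise is the case `noise τ ξ = ξ`.) -/
structure AuctionModel where
  arrivalRate : ℝ
  arrivalRate_pos : 0 < arrivalRate
  endRate : ℝ
  endRate_pos : 0 < endRate
  seedLaw : Measure ℝ
  seedLaw_prob : IsProbabilityMeasure seedLaw
  noise : ℝ≥0 → ℝ → ℝ
  noise_measurable : Measurable (fun z : ℝ≥0 × ℝ => noise z.1 z.2)
  noiseVar : ℝ≥0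
  noise_centred : ∀ τ, ∫ ξ, noise τ ξ ∂seedLaw = 0
  noise_subgaussian : ∀ τ, HasSubgaussianMGF (noise τ) noiseVar seedLaw

/-- `f` is continuous and piecewise linear on `[t 0, ∞)`, with breakpoints among
`t 0 < t 1 < ⋯ < t n`. -/
def IsPiecewiseLinear {n : ℕ} (t : Fin (n + 1) → ℝ) (f : ℝ → ℝ) : Prop :=
  (∀ i : Fin n, ∃ m c : ℝ, ∀ x ∈ Icc (t i.castSucc) (t i.succ), f x = m * x + c) ∧
    ∃ m c : ℝ, ∀ x ∈ Ici (t (Fin.last n)), f x = m * x + c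

/-- The class of rewards: piecewise linear, concave and nondecreasing functions on `[0, ∞)` with
breakpoints among the `t i`, constant after the last breakpoint. -/
def RewardClass {n : ℕ} (t : Fin (n + 1) → ℝ) : Set (ℝ → ℝ) :=
  {k | IsPiecewiseLinear t k ∧ ConcaveOn ℝ (Ici 0) k ∧ MonotoneOn k (Ici 0) ∧
    ∀ x ∈ Ici (t (Fin.last n)), k x = k (t (Fin.last n))}

/-- The class of competitions: piecewise linear (continuous) nondecreasing cumulative distribution
functions of a nonnegative price, with breakpoints among the `b i`. The total mass
`lim q ≤ 1` may be smaller than `1`; the missing mass is that of a price which is never beaten. -/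
def CompetitionClass {n : ℕ} (b : Fin (n + 1) → ℝ) : Set (ℝ → ℝ) :=
  {q | IsPiecewiseLinear b q ∧ MonotoneOn q (Ici 0) ∧ q 0 = 0 ∧ ∀ x ∈ Ici (0 : ℝ), q x ≤ 1}

/-! ### The price-to-beat -/

/-- The quantile function of `q`; it is `⊤` above the total mass of `q`. -/
def quantile (q : ℝ → ℝ) (u : ℝ) : EReal :=
  ⨅ (b : ℝ) (_ : 0 ≤ b ∧ u ≤ q b), (b : EReal)

/-- The law of the price-to-beat, whose cumulative distribution function is `q`
(see `priceLaw_Iic`). -/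
def priceLaw (q : ℝ → ℝ) : Measure EReal :=
  (volume.restrict (Icc (0 : ℝ) 1)).map (quantile q)

theorem measurable_quantile (q : ℝ → ℝ) : Measurable (quantile q) := by
  apply Monotone.measurable
  intro u v huv
  refine le_iInf fun b => le_iInf fun hb => ?_
  exact iInf_le_of_le b (iInf_le _ ⟨hb.1, huv.trans hb.2⟩)

instance isProbabilityMeasure_priceLaw (q : ℝ → ℝ) : IsProbabilityMeasure (priceLaw q) := by
  have : IsProbabilityMeasure (volume.restrict (Icc (0 : ℝ) 1)) := ⟨by simp⟩
  exact Measure.isProbabilityMeasure_map (measurable_quantile q).aemeasurable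

/-- Under `priceLaw q`, the probability of a price at most `x` is `q x`. -/
theorem priceLaw_Iic {q : ℝ → ℝ} (hmono : MonotoneOn q (Ici 0)) (hcont : ContinuousOn q (Ici 0))
    (h1 : ∀ x ∈ Ici (0 : ℝ), q x ≤ 1) {x : ℝ} (hx : 0 ≤ x) :
    priceLaw q (Iic (x : EReal)) = ENNReal.ofReal (q x) := by
  have key : ∀ u : ℝ, quantile q u ≤ (x : EReal) ↔ u ≤ q x := by
    intro u
    constructor
    · intro h
      by_contra hlt
      push Not at hlt
      have hev : ∀ᶠ y in 𝓝[Ici 0] x, q y < u := (hcont x hx).eventually (Iio_mem_nhds hlt)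
      have hev' : ∀ᶠ y in 𝓝[>] x, q y < u :=
        hev.filter_mono (nhdsWithin_mono x fun y (hy : x < y) => hx.trans hy.le)
      obtain ⟨y, hy, hxy⟩ := (hev'.and self_mem_nhdsWithin).exists
      have hxy' : x < y := hxy
      have hle : (y : EReal) ≤ quantile q u := by
        refine le_iInf fun b => le_iInf fun hb => ?_
        rw [EReal.coe_le_coe_iff]
        by_contra hby
        push Not at hby
        have := hmono hb.1 (hb.1.trans hby.le) hby.le
        linarith [hb.2]
      have := hle.trans h
      rw [EReal.coe_le_coe_iff] at this
      linarith
    · intro h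
      exact iInf_le_of_le x (iInf_le _ ⟨hx, h⟩)
  rw [priceLaw, Measure.map_apply (measurable_quantile q) measurableSet_Iic,
    Measure.restrict_apply (measurable_quantile q measurableSet_Iic)]
  have hset : quantile q ⁻¹' Iic (x : EReal) ∩ Icc 0 1 = Icc 0 (q x) := by
    ext u
    simp only [mem_inter_iff, mem_preimage, mem_Iic, mem_Icc, key]
    constructor
    · rintro ⟨h, h', -⟩
      exact ⟨h', h⟩
    · rintro ⟨h, h'⟩
      exact ⟨h', h, h'.trans (h1 x hx)⟩
  rw [hset, Real.volume_Icc, sub_zero]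

/-! ### The random episode -/

/-- What happens at one auction: the time since the previous auction request (since the beginning
of the episode, for the first one), the price-to-beat, and the seed of the noise. -/
abbrev AuctionData : Type := ℝ × EReal × ℝ

/-- An episode: its length, and the sequence of auction requests. -/
abbrev Episode : Type := ℝ × (ℕ → AuctionData)

/-- The law of the data of one auction, in competition `q`. -/
def auctionLaw (M : AuctionModel) (q : ℝ → ℝ) : Measure AuctionData :=
  (expMeasure M.arrivalRate).prod ((priceLaw q).prod M.seedLaw)

instance isProbabilityMeasure_auctionLaw (M : AuctionModel) (q : ℝ → ℝ) :
    IsProbabilityMeasure (auctionLaw M q) := by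
  have := isProbabilityMeasure_expMeasure M.arrivalRate_pos
  have := M.seedLaw_prob
  unfold auctionLaw
  infer_instance

/-- The law of an episode: an exponential length, independent of the auctions; the auction requests
form a Poisson process (i.i.d. exponential gaps), and prices and seeds are i.i.d. -/
def episodeLaw (M : AuctionModel) (q : ℝ → ℝ) : Measure Episode :=
  (expMeasure M.endRate).prod (Measure.infinitePi fun _ : ℕ => auctionLaw M q)

/-- Policies: the bid is a function of the age, the time elapsed since the last win. -/
abbrev Policy : Type := {π : ℝ≥0 → ℝ≥0 // Measurable π}

/-- The age at the `i`-th auction (counted from `0`) under the bidding rule `π`, if the age is `s`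
at the beginning of the episode. It is reset to `0` by a win, that is a bid exceeding the price. -/
def age (π : ℝ≥0 → ℝ≥0) (s : ℝ≥0) (ω : ℕ → AuctionData) : ℕ → ℝ≥0
  | 0 => s + (ω 0).1.toNNReal
  | i + 1 =>
    open Classical in
    (if (ω i).2.1 < ((π (age π s ω i) : ℝ) : EReal) then 0 else age π s ω i)
      + (ω (i + 1)).1.toNNReal

/-- The time of the `i`-th auction request, measured from the beginning of the episode. -/
def arrivalTime (ω : ℕ → AuctionData) (i : ℕ) : ℝ :=
  ∑ j ∈ Finset.range (i + 1), (ω j).1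

open Classical in
/-- The total value of an episode: the sum, over the auctions won before its end, of the reward plus
noise minus the price. -/
def payoff (M : AuctionModel) (k : ℝ → ℝ) (π : ℝ≥0 → ℝ≥0) (s : ℝ≥0) (e : Episode) : ℝ :=
  ∑' i : ℕ,
    if arrivalTime e.2 i ≤ e.1 ∧ (e.2 i).2.1 < ((π (age π s e.2 i) : ℝ) : EReal) then
      k (age π s e.2 i) + M.noise (age π s e.2 i) (e.2 i).2.2 - (e.2 i).2.1.toReal
    else 0

/-- The expected payoff `𝒰(k, q, π, s)` of `π` in the environment `(k, q)`, from age `s`. -/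
def expectedPayoff (M : AuctionModel) (k q : ℝ → ℝ) (π : ℝ≥0 → ℝ≥0) (s : ℝ≥0) : ℝ :=
  ∫ e, payoff M k π s e ∂(episodeLaw M q)

/-! ### Optimal policies -/

/-- The Bellman value: the maximal expected payoff from age `s`. -/
def bellmanValue (M : AuctionModel) (k q : ℝ → ℝ) (s : ℝ≥0) : ℝ :=
  ⨆ π : Policy, expectedPayoff M k q π.1 s

/-- The policy `𝒮(k, q)` produced by the solver,
`τ ↦ max (0, k τ + V⋆ 0 - V⋆ τ)` with `V⋆` the Bellman value. -/
def solver (M : AuctionModel) (k q : ℝ → ℝ) (τ : ℝ≥0) : ℝ≥0 :=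
  Real.toNNReal (k τ + bellmanValue M k q 0 - bellmanValue M k q τ)

/-- `π` is a policy with integrable payoff that is optimal from every age, among all policies
(whose payoffs are integrable as well). -/
def IsOptimal (M : AuctionModel) (k q : ℝ → ℝ) (π : ℝ≥0 → ℝ≥0) : Prop :=
  Measurable π ∧ ∀ s : ℝ≥0, Integrable (payoff M k π s) (episodeLaw M q) ∧
    ∀ ρ : Policy, Integrable (payoff M k ρ.1 s) (episodeLaw M q) ∧
      expectedPayoff M k q ρ.1 s ≤ expectedPayoff M k q π s

/-- The asymptotic bid `β(π) = lim_{t → ∞} π t`. -/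
def asymptoticBid (π : ℝ≥0 → ℝ≥0) : ℝ≥0 := limUnder atTop π

end DynamicBidding

end

noncomputable section

namespace DynamicBidding

/-! ### Exponential laws -/

/-! Integrating out the exponential lifetime weights the auction at time `θ` by `exp (-γ θ)`, so the
expected payoff is the sum of the expected discounted gains (`integrable_payoff_and_hasSum`). An
i.i.d. sequence has the same law after dropping its first term, so each policy obeys a one-step
equation (`sum_expectedGain_succ`), contracting with factor `discount` < 1. Hence bounded super- and
subsolutions bound its payoff from above and below.

The Bellman operator has a bounded fixed point `W`, the limit of its iterates from `0`. By concavity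
of `k` the operator preserves monotonicity of `k - W` (`monotone_sub_bellmanStep`). `verification`
shows that any bounded nonnegative measurable fixed point is the Bellman value and that its greedy
policy, which is the solver's, is optimal. The bid `max (0, k + W 0 - W)` is therefore nondecreasing
and bounded, so its limit is its supremum `β`.

For extension invariance, both competitions are driven by the same uniform variable. If they agree
on `[0, β]`, their prices coincide or are both at least `β` (`quantile_eq_or_of_eqOn`), and in the
latter case the best choice under `W` is not to win. So `W` is also a fixed point for the second
competition, and `verification` makes it the value there too. -/

theorem ae_pos_expMeasure {r : ℝ} (hr : 0 < r) : ∀ᵐ x ∂expMeasure r, 0 < x := by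
  have := isProbabilityMeasure_expMeasure hr
  rw [ae_iff]
  have h : {x : ℝ | ¬ 0 < x} = Iic 0 := by ext; simp
  rw [h, ← ofReal_cdf, cdf_expMeasure_eq hr]
  simp

theorem expMeasure_Ici {r : ℝ} (hr : 0 < r) {x : ℝ} (hx : 0 ≤ x) :
    expMeasure r (Ici x) = ENNReal.ofReal (Real.exp (-(r * x))) := by
  have := isProbabilityMeasure_expMeasure hr
  have : NullSingletonClass (expMeasure r) :=
    ⟨fun y => withDensity_absolutelyContinuous volume _ (Real.volume_singleton (a := y))⟩
  have hx' : 0 ≤ r * x := by positivity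
  rw [← measure_congr Ioi_ae_eq_Ici, ← compl_Iic, prob_compl_eq_one_sub measurableSet_Iic,
    ← ofReal_cdf, cdf_expMeasure_eq hr, if_pos hx, ← ENNReal.ofReal_one,
    ← ENNReal.ofReal_sub _ (by simpa using hx')]
  simp

/-! ### Shifting an i.i.d. sequence -/

/-- The sequence with first term `a`, followed by `ω`. -/
def seqCons {α : Type*} (a : α) (ω : ℕ → α) : ℕ → α
  | 0 => a
  | i + 1 => ω i

@[simp]
theorem seqCons_zero {α : Type*} (a : α) (ω : ℕ → α) : seqCons a ω 0 = a := rfl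

@[simp]
theorem seqCons_succ {α : Type*} (a : α) (ω : ℕ → α) (i : ℕ) : seqCons a ω (i + 1) = ω i := rfl

@[fun_prop]
theorem measurable_seqCons {α : Type*} [MeasurableSpace α] :
    Measurable fun z : α × (ℕ → α) => seqCons z.1 z.2 := by
  refine measurable_pi_lambda _ fun i => ?_
  cases i with
  | zero => exact measurable_fst
  | succ i => exact (measurable_pi_apply i).comp measurable_snd

/-- Product measures are determined by finite boxes, and prepending a coordinate only reindexes the
factors of a box. -/
theorem map_seqCons_infinitePi {α : Type*} [MeasurableSpace α] (P : Measure α)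
    [IsProbabilityMeasure P] :
    (P.prod (Measure.infinitePi fun _ : ℕ => P)).map (fun z => seqCons z.1 z.2) =
      Measure.infinitePi fun _ : ℕ => P := by
  classical
  refine Measure.eq_infinitePi _ fun s t ht => ?_
  obtain ⟨N, hN⟩ : ∃ N, s ⊆ Finset.range (N + 1) :=
    ⟨s.sup id, fun i hi => Finset.mem_range.2 (Nat.lt_succ_of_le (Finset.le_sup (f := id) hi))⟩
  -- Padding with `univ` turns the box over `s` into one over an initial segment of `ℕ`, which
  -- splits into its coordinate `0` and the rest.
  set t' : ℕ → Set α := fun i => if i ∈ s then t i else univ with ht'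
  have hm : ∀ i, MeasurableSet (t' i) := fun i => by
    simp only [ht']; split_ifs; exacts [ht i, .univ]
  have hpre : (fun z : α × (ℕ → α) => seqCons z.1 z.2) ⁻¹' (Set.pi s t) =
      t' 0 ×ˢ Set.pi (Finset.range N : Set ℕ) (fun i => t' (i + 1)) := by
    ext z
    simp only [mem_preimage, Set.mem_pi, mem_prod, Finset.mem_coe, Finset.mem_range]
    constructor
    · intro h
      refine ⟨?_, fun i _ => ?_⟩
      · simp only [ht']; split_ifs with h0
        exacts [h 0 h0, trivial]
      · simp only [ht']; split_ifs with h0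
        exacts [h _ h0, trivial]
    · rintro ⟨h0, h1⟩ i hi
      have hi' := Finset.mem_range.1 (hN hi)
      cases i with
      | zero => simpa [ht', hi] using h0
      | succ i => simpa [ht', hi] using h1 i (by omega)
  rw [Measure.map_apply measurable_seqCons
    (MeasurableSet.pi s.countable_toSet fun i _ => ht i), hpre, Measure.prod_prod,
    Measure.infinitePi_pi _ fun i _ => hm _, mul_comm, ← Finset.prod_range_succ' (fun i => P (t' i))]
  symm
  refine Finset.prod_subset_one_on_sdiff hN (fun i hi => ?_) (fun i hi => ?_)
  · simp [ht', (Finset.mem_sdiff.1 hi).2]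
  · simp [ht', hi]

theorem measurePreserving_seqCons {α : Type*} [MeasurableSpace α] (P : Measure α)
    [IsProbabilityMeasure P] :
    MeasurePreserving (fun z : α × (ℕ → α) => seqCons z.1 z.2)
      (P.prod (Measure.infinitePi fun _ : ℕ => P)) (Measure.infinitePi fun _ : ℕ => P) :=
  ⟨measurable_seqCons, map_seqCons_infinitePi P⟩

theorem lintegral_infinitePi_seqCons {α : Type*} [MeasurableSpace α] (P : Measure α)
    [IsProbabilityMeasure P] {F : (ℕ → α) → ℝ≥0∞} (hF : Measurable F) :
    ∫⁻ ω, F ω ∂(Measure.infinitePi fun _ : ℕ => P) =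
      ∫⁻ a, ∫⁻ ω, F (seqCons a ω) ∂(Measure.infinitePi fun _ : ℕ => P) ∂P := by
  rw [← (measurePreserving_seqCons P).lintegral_comp hF, lintegral_prod]
  exact (hF.comp measurable_seqCons).aemeasurable

theorem integral_infinitePi_seqCons {α : Type*} [MeasurableSpace α] (P : Measure α)
    [IsProbabilityMeasure P] {F : (ℕ → α) → ℝ} (hF : Measurable F)
    (hi : Integrable F (Measure.infinitePi fun _ : ℕ => P)) :
    ∫ ω, F ω ∂(Measure.infinitePi fun _ : ℕ => P) =
      ∫ a, ∫ ω, F (seqCons a ω) ∂(Measure.infinitePi fun _ : ℕ => P) ∂P := by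
  have hp := measurePreserving_seqCons P
  conv_lhs => rw [← hp.map_eq]
  rw [integral_map hp.measurable.aemeasurable hF.aestronglyMeasurable,
    integral_prod (fun z : α × (ℕ → α) => F (seqCons z.1 z.2))
      (hp.integrable_comp_of_integrable hi)]

/-! ### Series of integrable functions -/

/-- By Tonelli the series converges absolutely almost everywhere; there the partial sums converge to
the `tsum`, which gives its measurability. -/
theorem integrable_tsum_of_tsum_lintegral_ne_top {α : Type*} [MeasurableSpace α] {ν : Measure α}
    {f : ℕ → α → ℝ} (hf : ∀ i, Measurable (f i)) (h : ∑' i, ∫⁻ a, ‖f i a‖ₑ ∂ν ≠ ∞) :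
    Integrable (fun a => ∑' i, f i a) ν := by
  have hlt : ∫⁻ a, ∑' i, ‖f i a‖ₑ ∂ν < ∞ := by
    rw [lintegral_tsum fun i => (hf i).enorm.aemeasurable]
    exact h.lt_top
  have hae : ∀ᵐ a ∂ν, ∑' i, ‖f i a‖ₑ < ∞ :=
    ae_lt_top (Measurable.tsum fun i => (hf i).enorm) hlt.ne
  refine ⟨?_, ?_⟩
  · refine aestronglyMeasurable_of_tendsto_ae atTop
      (f := fun n a => ∑ i ∈ Finset.range n, f i a) (fun n => ?_) ?_
    · exact (Finset.measurable_sum _ fun i _ => hf i).aestronglyMeasurable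
    · filter_upwards [hae] with a ha
      have hs : Summable fun i => ‖f i a‖ := by
        have := ENNReal.summable_toReal ha.ne
        simpa using this
      exact hs.of_norm.hasSum.tendsto_sum_nat
  · refine lt_of_le_of_lt (lintegral_mono fun a => ?_) hlt
    exact enorm_tsum_le_tsum_enorm

/-! ### Gains, and the age process seen from the second auction -/

/-- Regularity of an environment: the reward `k` is nondecreasing, bounded by `K`, with decreasing
increments, and the prices which can be beaten lie in `[0, C]`. -/
structure RegularEnvironment (k q : ℝ → ℝ) (K C : ℝ) : Prop where
  monotone_reward : Monotone fun y : ℝ≥0 => k y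
  abs_reward_le : ∀ y : ℝ≥0, |k y| ≤ K
  increments_le : ∀ s s' x : ℝ≥0, s ≤ s' → k ↑(s' + x) - k ↑(s + x) ≤ k s' - k s
  price_mem : ∀ᵐ p ∂priceLaw q, 0 ≤ p ∧ p.toReal ≤ C

open Classical in
/-- The value of an auction taking place at age `y`. -/
def gain (M : AuctionModel) (k : ℝ → ℝ) (π : ℝ≥0 → ℝ≥0) (y : ℝ≥0) (a : AuctionData) : ℝ :=
  if a.2.1 < ((π y : ℝ) : EReal) then k y + M.noise y a.2.2 - a.2.1.toReal else 0

open Classical in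
/-- The age just after the first auction, from age `s`. -/
def nextAge (π : ℝ≥0 → ℝ≥0) (s : ℝ≥0) (a : AuctionData) : ℝ≥0 :=
  if a.2.1 < ((π (s + a.1.toNNReal) : ℝ) : EReal) then 0 else s + a.1.toNNReal

/-- The gain at the `i`-th auction, discounted by the probability that it takes place. -/
def discountedGain (M : AuctionModel) (k : ℝ → ℝ) (π : ℝ≥0 → ℝ≥0) (i : ℕ) (s : ℝ≥0)
    (ω : ℕ → AuctionData) : ℝ :=
  Real.exp (-(M.endRate * arrivalTime ω i)) * gain M k π (age π s ω i) (ω i)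

/-- The Markov property of the age: after the first auction the process restarts from `nextAge`. -/
theorem age_seqCons (π : ℝ≥0 → ℝ≥0) (s : ℝ≥0) (a : AuctionData) (ω : ℕ → AuctionData) (i : ℕ) :
    age π s (seqCons a ω) (i + 1) = age π (nextAge π s a) ω i := by
  induction i with
  | zero =>
    simp only [age, nextAge, seqCons_zero, seqCons_succ]
    split_ifs with h <;> simp [h]
  | succ i ih =>
    rw [age, ih, age]
    simp only [seqCons_succ]
    split_ifs with h <;> simp [h]

theorem arrivalTime_seqCons (a : AuctionData) (ω : ℕ → AuctionData) (i : ℕ) :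
    arrivalTime (seqCons a ω) (i + 1) = a.1 + arrivalTime ω i := by
  rw [arrivalTime, Finset.sum_range_succ', arrivalTime]
  simp [add_comm]

theorem discountedGain_zero (M : AuctionModel) (k : ℝ → ℝ) (π : ℝ≥0 → ℝ≥0) (s : ℝ≥0)
    (ω : ℕ → AuctionData) :
    discountedGain M k π 0 s ω =
      Real.exp (-(M.endRate * (ω 0).1)) * gain M k π (s + (ω 0).1.toNNReal) (ω 0) := by
  simp [discountedGain, arrivalTime, age]

theorem discountedGain_seqCons (M : AuctionModel) (k : ℝ → ℝ) (π : ℝ≥0 → ℝ≥0) (i : ℕ) (s : ℝ≥0)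
    (a : AuctionData) (ω : ℕ → AuctionData) :
    discountedGain M k π (i + 1) s (seqCons a ω) =
      Real.exp (-(M.endRate * a.1)) * discountedGain M k π i (nextAge π s a) ω := by
  simp only [discountedGain, age_seqCons, arrivalTime_seqCons, seqCons_succ]
  rw [← mul_assoc, ← Real.exp_add]
  ring_nf

/-! ### Measurability -/

theorem measurableSet_win {α : Type*} [MeasurableSpace α] {π : ℝ≥0 → ℝ≥0} (hπ : Measurable π)
    {y : α → ℝ≥0} (hy : Measurable y) {p : α → EReal} (hp : Measurable p) :
    MeasurableSet {x | p x < ((π (y x) : ℝ) : EReal)} :=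
  measurableSet_lt hp ((hπ.comp hy).coe_nnreal_real.coe_real_ereal)

@[fun_prop]
theorem measurable_gain (M : AuctionModel) {k : ℝ → ℝ} (hk : Monotone fun y : ℝ≥0 => k y)
    {π : ℝ≥0 → ℝ≥0} (hπ : Measurable π) :
    Measurable fun z : ℝ≥0 × AuctionData => gain M k π z.1 z.2 := by
  unfold gain
  refine Measurable.ite (measurableSet_win hπ measurable_fst (by fun_prop)) ?_ measurable_const
  refine Measurable.sub (Measurable.add (hk.measurable.comp measurable_fst) ?_) ?_
  · exact M.noise_measurable.comp (by fun_prop : Measurable fun z : ℝ≥0 × AuctionData =>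
      (z.1, z.2.2.2))
  · exact measurable_ereal_toReal.comp (by fun_prop)

theorem measurable_nextAge {π : ℝ≥0 → ℝ≥0} (hπ : Measurable π) :
    Measurable fun z : ℝ≥0 × AuctionData => nextAge π z.1 z.2 := by
  unfold nextAge
  exact Measurable.ite (measurableSet_win hπ (by fun_prop) (by fun_prop)) measurable_const
    (by fun_prop)

theorem measurable_age {π : ℝ≥0 → ℝ≥0} (hπ : Measurable π) (i : ℕ) :
    Measurable fun z : ℝ≥0 × (ℕ → AuctionData) => age π z.1 z.2 i := by
  induction i with
  | zero => simp only [age]; fun_prop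
  | succ i ih =>
    simp only [age]
    refine Measurable.add ?_ (by fun_prop)
    exact Measurable.ite (measurableSet_win hπ ih (by fun_prop)) measurable_const ih

theorem measurable_arrivalTime (i : ℕ) : Measurable fun ω => arrivalTime ω i := by
  unfold arrivalTime
  fun_prop

theorem measurable_gain_age (M : AuctionModel) {k : ℝ → ℝ} (hk : Monotone fun y : ℝ≥0 => k y)
    {π : ℝ≥0 → ℝ≥0} (hπ : Measurable π) (i : ℕ) :
    Measurable fun z : ℝ≥0 × (ℕ → AuctionData) => gain M k π (age π z.1 z.2 i) (z.2 i) :=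
  (measurable_gain M hk hπ).comp ((measurable_age hπ i).prodMk (by fun_prop))

theorem measurable_discountedGain (M : AuctionModel) {k : ℝ → ℝ}
    (hk : Monotone fun y : ℝ≥0 => k y) {π : ℝ≥0 → ℝ≥0} (hπ : Measurable π) (i : ℕ) :
    Measurable fun z : ℝ≥0 × (ℕ → AuctionData) => discountedGain M k π i z.1 z.2 := by
  refine Measurable.mul ?_ (measurable_gain_age M hk hπ i)
  have : Measurable fun z : ℝ≥0 × (ℕ → AuctionData) => arrivalTime z.2 i :=
    (measurable_arrivalTime i).comp measurable_snd
  fun_prop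

theorem measurable_discountedGain_left (M : AuctionModel) {k : ℝ → ℝ}
    (hk : Monotone fun y : ℝ≥0 => k y) {π : ℝ≥0 → ℝ≥0} (hπ : Measurable π) (i : ℕ) (s : ℝ≥0) :
    Measurable fun ω => discountedGain M k π i s ω :=
  (measurable_discountedGain M hk hπ i).comp measurable_prodMk_left

/-! ### The discount factor -/

/-- The expected discount up to the first auction. -/
def discount (M : AuctionModel) (q : ℝ → ℝ) : ℝ :=
  ∫ a, Real.exp (-(M.endRate * a.1)) ∂auctionLaw M q

theorem ae_pos_gap (M : AuctionModel) (q : ℝ → ℝ) : ∀ᵐ a ∂auctionLaw M q, 0 < a.1 := by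
  have := isProbabilityMeasure_expMeasure M.arrivalRate_pos
  have := M.seedLaw_prob
  exact Measure.quasiMeasurePreserving_fst.ae (ae_pos_expMeasure M.arrivalRate_pos)

theorem ae_exp_le_one (M : AuctionModel) (q : ℝ → ℝ) :
    ∀ᵐ a ∂auctionLaw M q, Real.exp (-(M.endRate * a.1)) ≤ 1 := by
  filter_upwards [ae_pos_gap M q] with a ha
  have := mul_pos M.endRate_pos ha
  rw [Real.exp_le_one_iff]
  linarith

theorem integrable_exp_gap (M : AuctionModel) (q : ℝ → ℝ) :
    Integrable (fun a : AuctionData => Real.exp (-(M.endRate * a.1))) (auctionLaw M q) := by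
  refine Integrable.of_bound (by fun_prop) 1 ?_
  filter_upwards [ae_exp_le_one M q] with a ha
  rwa [Real.norm_eq_abs, abs_of_pos (Real.exp_pos _)]

theorem discount_nonneg (M : AuctionModel) (q : ℝ → ℝ) : 0 ≤ discount M q :=
  integral_nonneg fun _ => (Real.exp_pos _).le

/-- The gap is almost surely positive, so `1 - exp (-γ gap)` is positive and cannot have integral
zero. This is the contraction constant of all later estimates. -/
theorem discount_lt_one (M : AuctionModel) (q : ℝ → ℝ) : discount M q < 1 := by
  have hi := integrable_exp_gap M q
  have hpos : 0 < ∫ a, (1 - Real.exp (-(M.endRate * a.1))) ∂auctionLaw M q := by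
    have hnn : 0 ≤ᵐ[auctionLaw M q] fun a => 1 - Real.exp (-(M.endRate * a.1)) := by
      filter_upwards [ae_exp_le_one M q] with a ha
      simpa using ha
    refine lt_of_le_of_ne (integral_nonneg_of_ae hnn) fun h0 => ?_
    have hz := (integral_eq_zero_iff_of_nonneg_ae hnn ((integrable_const _).sub hi)).1 h0.symm
    obtain ⟨a, ha, hz⟩ := ((ae_pos_gap M q).and hz).exists
    have := mul_pos M.endRate_pos ha
    have he : Real.exp (-(M.endRate * a.1)) < 1 := Real.exp_lt_one_iff.2 (by linarith)
    simp only [Pi.zero_apply] at hz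
    linarith
  rw [integral_sub (integrable_const _) hi] at hpos
  simp only [integral_const, probReal_univ, smul_eq_mul, mul_one, sub_pos] at hpos
  exact hpos

theorem lintegral_exp_gap (M : AuctionModel) (q : ℝ → ℝ) :
    ∫⁻ a, ‖Real.exp (-(M.endRate * a.1))‖ₑ ∂auctionLaw M q = ENNReal.ofReal (discount M q) := by
  rw [discount, ofReal_integral_eq_lintegral_ofReal (integrable_exp_gap M q)
    (Eventually.of_forall fun _ => (Real.exp_pos _).le)]
  simp only [Real.enorm_of_nonneg (Real.exp_pos _).le]

/-! ### Bounds on the gains -/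

/-- Since `|x| ≤ exp x + exp (-x)`, the moment generating function at `±1` bounds the first absolute
moment uniformly in the age. -/
theorem exists_lintegral_noise_le (M : AuctionModel) :
    ∃ B : ℝ≥0, ∀ τ, ∫⁻ ξ, ‖M.noise τ ξ‖ₑ ∂M.seedLaw ≤ B := by
  have := M.seedLaw_prob
  refine ⟨(2 * Real.exp (M.noiseVar / 2)).toNNReal, fun τ => ?_⟩
  have h := M.noise_subgaussian τ
  have h1 := h.integrable_exp_mul 1
  have h2 := h.integrable_exp_mul (-1)
  have e1 := h.mgf_le 1
  have e2 := h.mgf_le (-1)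
  simp only [mgf] at e1 e2
  rw [← ofReal_integral_norm_eq_lintegral_enorm h.integrable]
  refine ENNReal.ofReal_le_ofReal ?_
  calc ∫ ξ, ‖M.noise τ ξ‖ ∂M.seedLaw
      ≤ ∫ ξ, (Real.exp (1 * M.noise τ ξ) + Real.exp (-1 * M.noise τ ξ)) ∂M.seedLaw := by
        refine integral_mono h.integrable.norm (h1.add h2) fun ξ => ?_
        have a1 := Real.add_one_le_exp (1 * M.noise τ ξ)
        have a2 := Real.add_one_le_exp (-1 * M.noise τ ξ)
        have a3 := Real.exp_pos (1 * M.noise τ ξ)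
        have a4 := Real.exp_pos (-1 * M.noise τ ξ)
        simp only [Real.norm_eq_abs]
        rcases abs_cases (M.noise τ ξ) with h | h <;> linarith
    _ ≤ 2 * Real.exp (M.noiseVar / 2) := by
        rw [integral_add h1 h2]
        norm_num at e1 e2 ⊢
        linarith

theorem lintegral_auctionLaw_noise_le {M : AuctionModel} {B : ℝ≥0}
    (hB : ∀ τ, ∫⁻ ξ, ‖M.noise τ ξ‖ₑ ∂M.seedLaw ≤ B) (q : ℝ → ℝ) {y : ℝ → ℝ≥0}
    (hy : Measurable y) :
    ∫⁻ a, ‖M.noise (y a.1) a.2.2‖ₑ ∂auctionLaw M q ≤ B := by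
  have := isProbabilityMeasure_expMeasure M.arrivalRate_pos
  have := M.seedLaw_prob
  have hm : Measurable fun a : AuctionData => ‖M.noise (y a.1) a.2.2‖ₑ :=
    (M.noise_measurable.comp (by fun_prop : Measurable fun a : AuctionData =>
      (y a.1, a.2.2))).enorm
  rw [auctionLaw, lintegral_prod _ hm.aemeasurable]
  refine (lintegral_mono (g := fun _ => (B : ℝ≥0∞)) fun x => ?_).trans (by simp)
  have hx : Measurable fun z : EReal × ℝ => ‖M.noise (y x) z.2‖ₑ := hm.comp measurable_prodMk_left
  rw [lintegral_prod _ hx.aemeasurable]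
  exact (lintegral_mono (g := fun _ => (B : ℝ≥0∞)) fun p => hB _).trans (by simp)

theorem ae_price_mem {k q : ℝ → ℝ} {K C : ℝ} (M : AuctionModel) (h : RegularEnvironment k q K C) :
    ∀ᵐ a ∂auctionLaw M q, 0 ≤ a.2.1 ∧ a.2.1.toReal ≤ C := by
  have := isProbabilityMeasure_expMeasure M.arrivalRate_pos
  have := M.seedLaw_prob
  exact (Measure.quasiMeasurePreserving_fst.comp Measure.quasiMeasurePreserving_snd).ae h.price_mem

theorem exists_lintegral_gain_le (M : AuctionModel) {k q : ℝ → ℝ} {K C : ℝ}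
    (h : RegularEnvironment k q K C) :
    ∃ B : ℝ≥0, ∀ (π : ℝ≥0 → ℝ≥0) (s : ℝ≥0), ∫⁻ a, ‖Real.exp (-(M.endRate * a.1)) *
      gain M k π (s + a.1.toNNReal) a‖ₑ ∂auctionLaw M q ≤ B := by
  obtain ⟨B, hB⟩ := exists_lintegral_noise_le M
  refine ⟨(K + C).toNNReal + B, fun π s => ?_⟩
  calc ∫⁻ a, ‖Real.exp (-(M.endRate * a.1)) * gain M k π (s + a.1.toNNReal) a‖ₑ ∂auctionLaw M q
      ≤ ∫⁻ a, (ENNReal.ofReal (K + C) + ‖M.noise (s + a.1.toNNReal) a.2.2‖ₑ)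
          ∂auctionLaw M q := by
        refine lintegral_mono_ae ?_
        filter_upwards [ae_price_mem M h, ae_exp_le_one M q] with a ha he
        have h0 := EReal.toReal_nonneg ha.1
        have hk := h.abs_reward_le (s + a.1.toNNReal)
        rw [Real.enorm_eq_ofReal_abs, Real.enorm_eq_ofReal_abs,
          ← ENNReal.ofReal_add (by linarith [(abs_nonneg _).trans hk]) (abs_nonneg _)]
        refine ENNReal.ofReal_le_ofReal ?_
        rw [abs_mul, abs_of_pos (Real.exp_pos _)]
        refine (mul_le_of_le_one_left (abs_nonneg _) he).trans ?_
        unfold gain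
        split_ifs
        · rw [abs_le] at hk ⊢
          have := abs_le.1 (le_refl |M.noise (s + a.1.toNNReal) a.2.2|)
          constructor <;> linarith [hk.1, hk.2, ha.2]
        · have := abs_nonneg (M.noise (s + a.1.toNNReal) a.2.2)
          rw [abs_zero]
          linarith [(abs_nonneg _).trans hk, ha.2]
    _ ≤ _ := by
        rw [lintegral_add_left measurable_const]
        simp only [lintegral_const, measure_univ, mul_one, ENNReal.coe_add]
        gcongr
        · exact le_rfl
        · exact lintegral_auctionLaw_noise_le hB q (y := fun x => s + x.toNNReal) (by fun_prop)

/-- Each auction preceding the `i`-th contributes one factor `discount`. The induction is over all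
initial ages because the first auction changes the age. -/
theorem lintegral_discountedGain_le {M : AuctionModel} {k q : ℝ → ℝ}
    (hk : Monotone fun y : ℝ≥0 => k y) {π : ℝ≥0 → ℝ≥0} (hπ : Measurable π) {B : ℝ≥0}
    (hB : ∀ s : ℝ≥0, ∫⁻ a, ‖Real.exp (-(M.endRate * a.1)) *
      gain M k π (s + a.1.toNNReal) a‖ₑ ∂auctionLaw M q ≤ B) (i : ℕ) (s : ℝ≥0) :
    ∫⁻ ω, ‖discountedGain M k π i s ω‖ₑ ∂(Measure.infinitePi fun _ : ℕ => auctionLaw M q) ≤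
      ENNReal.ofReal (discount M q) ^ i * B := by
  induction i generalizing s with
  | zero =>
    rw [lintegral_infinitePi_seqCons _ (measurable_discountedGain_left M hk hπ 0 s).enorm]
    simpa [discountedGain_zero] using hB s
  | succ i ih =>
    rw [lintegral_infinitePi_seqCons _ (measurable_discountedGain_left M hk hπ (i + 1) s).enorm]
    calc _ ≤ ∫⁻ a, ‖Real.exp (-(M.endRate * a.1))‖ₑ * (ENNReal.ofReal (discount M q) ^ i * B)
          ∂auctionLaw M q := by
          refine lintegral_mono fun a => ?_
          simp only [discountedGain_seqCons, enorm_mul]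
          rw [lintegral_const_mul' _ _ enorm_ne_top]
          gcongr
          exact ih _
      _ = _ := by
          rw [lintegral_mul_const _ (by fun_prop), lintegral_exp_gap, pow_succ']
          ring

/-! ### The expected payoff as a sum of discounted gains -/

/-- The expectation of the discounted gain at the `i`-th auction. -/
def expectedGain (M : AuctionModel) (k q : ℝ → ℝ) (π : ℝ≥0 → ℝ≥0) (i : ℕ) (s : ℝ≥0) : ℝ :=
  ∫ ω, discountedGain M k π i s ω ∂(Measure.infinitePi fun _ : ℕ => auctionLaw M q)

open Classical in
/-- The contribution of the `i`-th auction to the payoff of an episode. -/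
def payoffTerm (M : AuctionModel) (k : ℝ → ℝ) (π : ℝ≥0 → ℝ≥0) (s : ℝ≥0) (i : ℕ) (e : Episode) : ℝ :=
  if arrivalTime e.2 i ≤ e.1 ∧ (e.2 i).2.1 < ((π (age π s e.2 i) : ℝ) : EReal) then
    k (age π s e.2 i) + M.noise (age π s e.2 i) (e.2 i).2.2 - (e.2 i).2.1.toReal
  else 0

/-- For fixed auctions the term depends on the lifetime only through the indicator of surviving to
the arrival; integrating over the lifetime then produces the discount factor. -/
theorem payoffTerm_eq (M : AuctionModel) (k : ℝ → ℝ) (π : ℝ≥0 → ℝ≥0) (s : ℝ≥0) (i : ℕ)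
    (x : ℝ) (ω : ℕ → AuctionData) :
    payoffTerm M k π s i (x, ω) =
      (Ici (arrivalTime ω i)).indicator (fun _ => gain M k π (age π s ω i) (ω i)) x := by
  by_cases h : arrivalTime ω i ≤ x <;> simp [payoffTerm, gain, h]

theorem measurable_payoffTerm (M : AuctionModel) {k : ℝ → ℝ} (hk : Monotone fun y : ℝ≥0 => k y)
    {π : ℝ≥0 → ℝ≥0} (hπ : Measurable π) (s : ℝ≥0) (i : ℕ) :
    Measurable (payoffTerm M k π s i) := by
  have heq : payoffTerm M k π s i = {e : Episode | arrivalTime e.2 i ≤ e.1}.indicator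
      fun e => gain M k π (age π s e.2 i) (e.2 i) := by
    ext e
    by_cases h : arrivalTime e.2 i ≤ e.1 <;> simp [payoffTerm, gain, h]
  rw [heq]
  refine Measurable.indicator ?_ (measurableSet_le ?_ measurable_fst)
  · exact (measurable_gain_age M hk hπ i).comp (measurable_const.prodMk measurable_snd)
  · exact (measurable_arrivalTime i).comp measurable_snd

theorem ae_arrivalTime_nonneg (M : AuctionModel) (q : ℝ → ℝ) (i : ℕ) :
    ∀ᵐ ω ∂(Measure.infinitePi fun _ : ℕ => auctionLaw M q), 0 ≤ arrivalTime ω i := by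
  have h : ∀ j : ℕ, ∀ᵐ ω ∂(Measure.infinitePi fun _ : ℕ => auctionLaw M q), 0 < (ω j).1 :=
    fun j => (measurePreserving_eval_infinitePi
      (fun _ : ℕ => auctionLaw M q) j).quasiMeasurePreserving.ae (ae_pos_gap M q)
  filter_upwards [ae_all_iff.2 h] with ω hω
  exact Finset.sum_nonneg fun j _ => (hω j).le

theorem lintegral_payoffTerm (M : AuctionModel) {k : ℝ → ℝ} (q : ℝ → ℝ)
    (hk : Monotone fun y : ℝ≥0 => k y)
    {π : ℝ≥0 → ℝ≥0} (hπ : Measurable π) (s : ℝ≥0) (i : ℕ) :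
    ∫⁻ e, ‖payoffTerm M k π s i e‖ₑ ∂episodeLaw M q =
      ∫⁻ ω, ‖discountedGain M k π i s ω‖ₑ ∂(Measure.infinitePi fun _ : ℕ => auctionLaw M q) := by
  have := isProbabilityMeasure_expMeasure M.endRate_pos
  rw [episodeLaw, lintegral_prod_symm _ (measurable_payoffTerm M hk hπ s i).enorm.aemeasurable]
  refine lintegral_congr_ae ?_
  filter_upwards [ae_arrivalTime_nonneg M q i] with ω hω
  simp only [payoffTerm_eq, enorm_indicator_eq_indicator_enorm]
  rw [lintegral_indicator_const measurableSet_Ici, expMeasure_Ici M.endRate_pos hω,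
    discountedGain, enorm_mul, Real.enorm_of_nonneg (Real.exp_pos _).le, mul_comm]

theorem integral_payoffTerm (M : AuctionModel) (k q : ℝ → ℝ) (π : ℝ≥0 → ℝ≥0) (s : ℝ≥0) (i : ℕ)
    (hi : Integrable (payoffTerm M k π s i) (episodeLaw M q)) :
    ∫ e, payoffTerm M k π s i e ∂episodeLaw M q = expectedGain M k q π i s := by
  have := isProbabilityMeasure_expMeasure M.endRate_pos
  rw [episodeLaw, integral_prod_symm _ hi]
  refine integral_congr_ae ?_
  filter_upwards [ae_arrivalTime_nonneg M q i] with ω hω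
  simp only [payoffTerm_eq]
  rw [integral_indicator_const _ measurableSet_Ici, measureReal_def,
    expMeasure_Ici M.endRate_pos hω, discountedGain, ENNReal.toReal_ofReal (Real.exp_pos _).le,
    smul_eq_mul]

/-- All policies have an integrable payoff, whose expectation is the sum of the expected discounted
gains. -/
theorem integrable_payoff_and_hasSum (M : AuctionModel) {k q : ℝ → ℝ} {K C : ℝ}
    (h : RegularEnvironment k q K C) {π : ℝ≥0 → ℝ≥0} (hπ : Measurable π) (s : ℝ≥0) :
    Integrable (payoff M k π s) (episodeLaw M q) ∧
      HasSum (fun i => expectedGain M k q π i s) (expectedPayoff M k q π s) := by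
  obtain ⟨B, hB⟩ := exists_lintegral_gain_le M h
  have hm := measurable_payoffTerm M h.monotone_reward hπ s
  have hle : ∀ i, ∫⁻ e, ‖payoffTerm M k π s i e‖ₑ ∂episodeLaw M q ≤
      ENNReal.ofReal (discount M q) ^ i * B := fun i => by
    rw [lintegral_payoffTerm M q h.monotone_reward hπ]
    exact lintegral_discountedGain_le h.monotone_reward hπ (hB π) i s
  have hlt : ENNReal.ofReal (discount M q) < 1 := by
    rw [ENNReal.ofReal_lt_one]
    exact discount_lt_one M q
  have htop : ∑' i, ∫⁻ e, ‖payoffTerm M k π s i e‖ₑ ∂episodeLaw M q ≠ ∞ := by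
    refine ne_top_of_le_ne_top ?_ (ENNReal.tsum_le_tsum hle)
    rw [ENNReal.tsum_mul_right, ENNReal.tsum_geometric]
    exact ENNReal.mul_ne_top (ENNReal.inv_ne_top.2 (tsub_pos_of_lt hlt).ne') ENNReal.coe_ne_top
  have hint : ∀ i, Integrable (payoffTerm M k π s i) (episodeLaw M q) := fun i =>
    ⟨(hm i).aestronglyMeasurable,
      (ENNReal.le_tsum i).trans_lt htop.lt_top⟩
  refine ⟨integrable_tsum_of_tsum_lintegral_ne_top hm htop, ?_⟩
  have hs := hasSum_integral_of_summable_integral_norm hint (by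
    have := ENNReal.summable_toReal htop
    refine this.congr fun i => ?_
    rw [integral_norm_eq_lintegral_enorm (hm i).aestronglyMeasurable])
  simp only [integral_payoffTerm M k q π s _ (hint _)] at hs
  exact hs

/-! ### First-step analysis -/

theorem integrable_discountedGain (M : AuctionModel) {k q : ℝ → ℝ} {K C : ℝ}
    (h : RegularEnvironment k q K C) {π : ℝ≥0 → ℝ≥0} (hπ : Measurable π) (i : ℕ) (s : ℝ≥0) :
    Integrable (discountedGain M k π i s) (Measure.infinitePi fun _ : ℕ => auctionLaw M q) := by
  obtain ⟨B, hB⟩ := exists_lintegral_gain_le M h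
  exact ⟨(measurable_discountedGain_left M h.monotone_reward hπ i s).aestronglyMeasurable,
    (lintegral_discountedGain_le h.monotone_reward hπ (hB π) i s).trans_lt
      (ENNReal.mul_lt_top (ENNReal.pow_lt_top ENNReal.ofReal_lt_top) ENNReal.coe_lt_top)⟩

theorem measurable_expectedGain (M : AuctionModel) {k : ℝ → ℝ} (q : ℝ → ℝ)
    (hk : Monotone fun y : ℝ≥0 => k y) {π : ℝ≥0 → ℝ≥0} (hπ : Measurable π) (i : ℕ) :
    Measurable (expectedGain M k q π i) :=
  (measurable_discountedGain M hk hπ i).stronglyMeasurable.integral_prod_right'.measurable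

theorem exists_abs_expectedGain_le (M : AuctionModel) {k q : ℝ → ℝ} {K C : ℝ}
    (h : RegularEnvironment k q K C) {π : ℝ≥0 → ℝ≥0} (hπ : Measurable π) (i : ℕ) :
    ∃ B : ℝ, ∀ s, |expectedGain M k q π i s| ≤ B := by
  obtain ⟨B, hB⟩ := exists_lintegral_gain_le M h
  refine ⟨(ENNReal.ofReal (discount M q) ^ i * B).toReal, fun s => ?_⟩
  have hm := (measurable_discountedGain_left M h.monotone_reward hπ i s).aestronglyMeasurable
    (μ := Measure.infinitePi fun _ : ℕ => auctionLaw M q)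
  refine (norm_integral_le_integral_norm (discountedGain M k π i s)).trans ?_
  rw [integral_norm_eq_lintegral_enorm hm]
  exact ENNReal.toReal_mono (ENNReal.mul_ne_top (ENNReal.pow_ne_top ENNReal.ofReal_ne_top)
    ENNReal.coe_ne_top) (lintegral_discountedGain_le h.monotone_reward hπ (hB π) i s)

theorem expectedGain_succ (M : AuctionModel) {k q : ℝ → ℝ} {K C : ℝ}
    (h : RegularEnvironment k q K C) {π : ℝ≥0 → ℝ≥0} (hπ : Measurable π) (i : ℕ) (s : ℝ≥0) :
    expectedGain M k q π (i + 1) s =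
      ∫ a, Real.exp (-(M.endRate * a.1)) * expectedGain M k q π i (nextAge π s a)
        ∂auctionLaw M q := by
  rw [expectedGain, integral_infinitePi_seqCons _
    (measurable_discountedGain_left M h.monotone_reward hπ _ s)
    (integrable_discountedGain M h hπ _ s)]
  simp only [discountedGain_seqCons, integral_const_mul, expectedGain]

theorem integrable_exp_mul (M : AuctionModel) (q : ℝ → ℝ) {f : AuctionData → ℝ}
    (hf : Measurable f) {c : ℝ} (hc : ∀ᵐ a ∂auctionLaw M q, |f a| ≤ c) :
    Integrable (fun a => Real.exp (-(M.endRate * a.1)) * f a) (auctionLaw M q) := by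
  refine Integrable.of_bound (by fun_prop) c ?_
  filter_upwards [hc, ae_exp_le_one M q] with a ha he
  rw [Real.norm_eq_abs, abs_mul, abs_of_pos (Real.exp_pos _)]
  exact (mul_le_of_le_one_left (abs_nonneg _) he).trans ha

open Classical in
/-- The value of an auction taking place at age `y`, without the noise. -/
def meanGain (k : ℝ → ℝ) (π : ℝ≥0 → ℝ≥0) (y : ℝ≥0) (p : EReal) : ℝ :=
  if p < ((π y : ℝ) : EReal) then k y - p.toReal else 0

theorem measurable_meanGain {k : ℝ → ℝ} (hk : Monotone fun y : ℝ≥0 => k y)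
    {π : ℝ≥0 → ℝ≥0} (hπ : Measurable π) :
    Measurable fun z : ℝ≥0 × EReal => meanGain k π z.1 z.2 := by
  unfold meanGain
  exact Measurable.ite (measurableSet_win hπ measurable_fst measurable_snd)
    ((hk.measurable.comp measurable_fst).sub (measurable_ereal_toReal.comp measurable_snd))
    measurable_const

theorem ae_abs_meanGain_le (M : AuctionModel) {k q : ℝ → ℝ} {K C : ℝ}
    (h : RegularEnvironment k q K C) (π : ℝ≥0 → ℝ≥0) :
    ∀ᵐ a ∂auctionLaw M q, ∀ y, |meanGain k π y a.2.1| ≤ K + C := by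
  filter_upwards [ae_price_mem M h] with a ha y
  have h0 := EReal.toReal_nonneg ha.1
  have hk := h.abs_reward_le y
  unfold meanGain
  split_ifs
  · rw [abs_le] at hk ⊢
    constructor <;> linarith [hk.1, hk.2, ha.2]
  · rw [abs_zero]
    linarith [(abs_nonneg _).trans hk, ha.2]

/-- The age and the event of winning depend only on the gap and the price, so integrating the seed
first removes the centred noise. -/
theorem expectedGain_zero (M : AuctionModel) {k q : ℝ → ℝ} {K C : ℝ}
    (h : RegularEnvironment k q K C) {π : ℝ≥0 → ℝ≥0} (hπ : Measurable π) (s : ℝ≥0) :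
    expectedGain M k q π 0 s =
      ∫ a, Real.exp (-(M.endRate * a.1)) * meanGain k π (s + a.1.toNNReal) a.2.1
        ∂auctionLaw M q := by
  have := isProbabilityMeasure_expMeasure M.arrivalRate_pos
  have := M.seedLaw_prob
  obtain ⟨B, hB⟩ := exists_lintegral_gain_le M h
  rw [expectedGain, integral_infinitePi_seqCons _
    (measurable_discountedGain_left M h.monotone_reward hπ _ s)
    (integrable_discountedGain M h hπ _ s)]
  simp only [discountedGain_zero, seqCons_zero, integral_const, probReal_univ, one_smul]
  have hgm : Measurable fun a : AuctionData => gain M k π (s + a.1.toNNReal) a :=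
    (measurable_gain M h.monotone_reward hπ).comp
      (by fun_prop : Measurable fun a : AuctionData => (s + a.1.toNNReal, a))
  have hmm : Measurable fun a : AuctionData => meanGain k π (s + a.1.toNNReal) a.2.1 :=
    (measurable_meanGain h.monotone_reward hπ).comp
      (by fun_prop : Measurable fun a : AuctionData => (s + a.1.toNNReal, a.2.1))
  have i1 : Integrable (fun a => Real.exp (-(M.endRate * a.1)) *
      gain M k π (s + a.1.toNNReal) a) (auctionLaw M q) :=
    ⟨by fun_prop, (hB π s).trans_lt ENNReal.coe_lt_top⟩
  have i2 := integrable_exp_mul M q hmm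
    ((ae_abs_meanGain_le M h π).mono fun a ha => ha (s + a.1.toNNReal))
  -- Fubini is applied to the difference of the two integrands: on a win it is the discounted noise,
  -- on a loss it is zero.
  rw [← sub_eq_zero, ← integral_sub i1 i2]
  have i3 : Integrable (fun a => Real.exp (-(M.endRate * a.1)) *
      gain M k π (s + a.1.toNNReal) a - Real.exp (-(M.endRate * a.1)) *
      meanGain k π (s + a.1.toNNReal) a.2.1) (auctionLaw M q) := i1.sub i2
  rw [auctionLaw] at i3 ⊢
  rw [integral_prod _ i3]
  have hae := i3.prod_right_ae
  refine integral_eq_zero_of_ae ?_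
  filter_upwards [hae] with x hx
  rw [integral_prod _ hx]
  refine integral_eq_zero_of_ae (Eventually.of_forall fun p => ?_)
  by_cases hw : p < ((π (s + x.toNNReal) : ℝ) : EReal)
  · have : ∀ ξ, Real.exp (-(M.endRate * x)) * gain M k π (s + x.toNNReal) (x, p, ξ) -
        Real.exp (-(M.endRate * x)) * meanGain k π (s + x.toNNReal) p =
        Real.exp (-(M.endRate * x)) * M.noise (s + x.toNNReal) ξ := fun ξ => by
      simp only [gain, meanGain, hw, if_true]
      ring
    simp only [this, integral_const_mul, M.noise_centred, mul_zero, Pi.zero_apply]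
  · simp [gain, meanGain, hw]

/-! ### Verification -/

open Classical in
/-- The value of an auction taking place at age `y`, without the noise, followed by the continuation
value `W`. -/
def continuation (k : ℝ → ℝ) (π : ℝ≥0 → ℝ≥0) (W : ℝ≥0 → ℝ) (y : ℝ≥0) (p : EReal) : ℝ :=
  if p < ((π y : ℝ) : EReal) then k y - p.toReal + W 0 else W y

theorem measurable_comp_nextAge {π : ℝ≥0 → ℝ≥0} (hπ : Measurable π) {W : ℝ≥0 → ℝ}
    (hW : Measurable W) (s : ℝ≥0) : Measurable fun a => W (nextAge π s a) :=
  hW.comp ((measurable_nextAge hπ).comp measurable_prodMk_left)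

/-- The expected value of following `π` up to the first auction, with continuation value `W`. -/
def policyStep (M : AuctionModel) (k q : ℝ → ℝ) (π : ℝ≥0 → ℝ≥0) (W : ℝ≥0 → ℝ) (s : ℝ≥0) : ℝ :=
  ∫ a, Real.exp (-(M.endRate * a.1)) * continuation k π W (s + a.1.toNNReal) a.2.1 ∂auctionLaw M q

theorem continuation_eq (k : ℝ → ℝ) (π : ℝ≥0 → ℝ≥0) (W : ℝ≥0 → ℝ) (s : ℝ≥0) (a : AuctionData) :
    continuation k π W (s + a.1.toNNReal) a.2.1 =
      meanGain k π (s + a.1.toNNReal) a.2.1 + W (nextAge π s a) := by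
  by_cases hw : a.2.1 < ((π (s + a.1.toNNReal) : ℝ) : EReal) <;>
    simp [continuation, meanGain, nextAge, hw]

theorem integrable_exp_mul_meanGain (M : AuctionModel) {k q : ℝ → ℝ} {K C : ℝ}
    (h : RegularEnvironment k q K C) {π : ℝ≥0 → ℝ≥0} (hπ : Measurable π) (s : ℝ≥0) :
    Integrable (fun a => Real.exp (-(M.endRate * a.1)) *
      meanGain k π (s + a.1.toNNReal) a.2.1) (auctionLaw M q) := by
  have hmm : Measurable fun a : AuctionData => meanGain k π (s + a.1.toNNReal) a.2.1 :=
    (measurable_meanGain h.monotone_reward hπ).comp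
      (by fun_prop : Measurable fun a : AuctionData => (s + a.1.toNNReal, a.2.1))
  exact integrable_exp_mul M q hmm
    ((ae_abs_meanGain_le M h π).mono fun a ha => ha (s + a.1.toNNReal))

theorem integrable_exp_mul_nextAge (M : AuctionModel) (q : ℝ → ℝ) {π : ℝ≥0 → ℝ≥0}
    (hπ : Measurable π) {W : ℝ≥0 → ℝ} (hW : Measurable W) {c : ℝ} (hc : ∀ s, |W s| ≤ c) (s : ℝ≥0) :
    Integrable (fun a => Real.exp (-(M.endRate * a.1)) * W (nextAge π s a)) (auctionLaw M q) :=
  integrable_exp_mul M q (measurable_comp_nextAge hπ hW s) (Eventually.of_forall fun _ => hc _)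

theorem integrable_continuation (M : AuctionModel) {k q : ℝ → ℝ} {K C : ℝ}
    (h : RegularEnvironment k q K C) {π : ℝ≥0 → ℝ≥0} (hπ : Measurable π) {W : ℝ≥0 → ℝ}
    (hW : Measurable W) {c : ℝ} (hc : ∀ s, |W s| ≤ c) (s : ℝ≥0) :
    Integrable (fun a => Real.exp (-(M.endRate * a.1)) *
      continuation k π W (s + a.1.toNNReal) a.2.1) (auctionLaw M q) := by
  simp only [continuation_eq, mul_add]
  exact (integrable_exp_mul_meanGain M h hπ s).add (integrable_exp_mul_nextAge M q hπ hW hc s)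

theorem policyStep_eq (M : AuctionModel) {k q : ℝ → ℝ} {K C : ℝ}
    (h : RegularEnvironment k q K C) {π : ℝ≥0 → ℝ≥0} (hπ : Measurable π) {W : ℝ≥0 → ℝ}
    (hW : Measurable W) {c : ℝ} (hc : ∀ s, |W s| ≤ c) (s : ℝ≥0) :
    policyStep M k q π W s = expectedGain M k q π 0 s +
      ∫ a, Real.exp (-(M.endRate * a.1)) * W (nextAge π s a) ∂auctionLaw M q := by
  simp only [policyStep, continuation_eq, mul_add]
  rw [expectedGain_zero M h hπ, integral_add (integrable_exp_mul_meanGain M h hπ s)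
    (integrable_exp_mul_nextAge M q hπ hW hc s)]

/-- First-step analysis of the payoff truncated to `N + 1` auctions; it drives the inductions
comparing a policy's payoff with a sub- or supersolution. -/
theorem sum_expectedGain_succ (M : AuctionModel) {k q : ℝ → ℝ} {K C : ℝ}
    (h : RegularEnvironment k q K C) {π : ℝ≥0 → ℝ≥0} (hπ : Measurable π) (N : ℕ) (s : ℝ≥0) :
    ∑ i ∈ Finset.range (N + 1), expectedGain M k q π i s = policyStep M k q π
      (fun y => ∑ i ∈ Finset.range N, expectedGain M k q π i y) s := by
  choose B hB using exists_abs_expectedGain_le M h hπ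
  have hm := measurable_expectedGain M q h.monotone_reward hπ
  rw [policyStep_eq M h hπ (Finset.measurable_sum _ fun i _ => hm i)
    (c := ∑ i ∈ Finset.range N, B i) (fun y => (Finset.abs_sum_le_sum_abs _ _).trans
      (Finset.sum_le_sum fun i _ => hB i y)), Finset.sum_range_succ', add_comm]
  simp only [Finset.mul_sum, expectedGain_succ M h hπ]
  rw [integral_finsetSum]
  exact fun i _ => integrable_exp_mul_nextAge M q hπ (hm i) (hB i) s

/-- One-sided contraction: the immediate gains cancel and only the discounted continuation values
differ. -/
theorem policyStep_le_add (M : AuctionModel) {k q : ℝ → ℝ} {K C : ℝ}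
    (h : RegularEnvironment k q K C) {π : ℝ≥0 → ℝ≥0} (hπ : Measurable π) {W W' : ℝ≥0 → ℝ}
    (hW : Measurable W) (hW' : Measurable W') {c c' d : ℝ} (hc : ∀ s, |W s| ≤ c)
    (hc' : ∀ s, |W' s| ≤ c') (hd : ∀ s, W s ≤ W' s + d) (s : ℝ≥0) :
    policyStep M k q π W s ≤ policyStep M k q π W' s + d * discount M q := by
  have i1 := integrable_exp_mul_nextAge M q hπ hW hc s
  have i2 := integrable_exp_mul_nextAge M q hπ hW' hc' s
  have i3 := (integrable_exp_gap M q).const_mul d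
  rw [policyStep_eq M h hπ hW hc, policyStep_eq M h hπ hW' hc', add_assoc, discount,
    ← integral_const_mul, ← integral_add i2 i3]
  refine add_le_add le_rfl (integral_mono i1 (i2.add i3) fun a => ?_)
  have := mul_le_mul_of_nonneg_left (hd (nextAge π s a)) (Real.exp_pos (-(M.endRate * a.1))).le
  simp only
  linarith

/-- A bounded supersolution of the policy equation dominates the expected payoff. -/
theorem expectedPayoff_le_of_policyStep_le (M : AuctionModel) {k q : ℝ → ℝ} {K C : ℝ}
    (h : RegularEnvironment k q K C) {π : ℝ≥0 → ℝ≥0} (hπ : Measurable π) {W : ℝ≥0 → ℝ}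
    (hW : Measurable W) {c : ℝ} (hc : ∀ s, |W s| ≤ c) (hstep : ∀ s, policyStep M k q π W s ≤ W s)
    (s : ℝ≥0) : expectedPayoff M k q π s ≤ W s := by
  choose B hB using exists_abs_expectedGain_le M h hπ
  have hm := measurable_expectedGain M q h.monotone_reward hπ
  -- The bound `0 ≤ W + c` starts the induction, and each step multiplies the error by `discount`.
  have key : ∀ (N : ℕ) (s : ℝ≥0), ∑ i ∈ Finset.range N, expectedGain M k q π i s ≤
      W s + c * discount M q ^ N := by
    intro N
    induction N with
    | zero => intro s; simpa [neg_le_iff_add_nonneg] using (abs_le.1 (hc s)).1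
    | succ N ih =>
      intro s
      rw [sum_expectedGain_succ M h hπ, pow_succ, ← mul_assoc]
      have := policyStep_le_add M h hπ (Finset.measurable_sum _ fun i _ => hm i) hW
        (c := ∑ i ∈ Finset.range N, B i) (fun y => (Finset.abs_sum_le_sum_abs _ _).trans
          (Finset.sum_le_sum fun i _ => hB i y)) hc ih s
      linarith [hstep s]
  have ht : Tendsto (fun N => W s + c * discount M q ^ N) atTop (𝓝 (W s + c * 0)) :=
    ((tendsto_pow_atTop_nhds_zero_of_lt_one (discount_nonneg M q)
      (discount_lt_one M q)).const_mul c).const_add _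
  rw [mul_zero, add_zero] at ht
  exact le_of_tendsto_of_tendsto' (integrable_payoff_and_hasSum M h hπ s).2.tendsto_sum_nat ht
    fun N => key N s

/-- A bounded subsolution of the policy equation is dominated by the expected payoff. -/
theorem le_expectedPayoff_of_le_policyStep (M : AuctionModel) {k q : ℝ → ℝ} {K C : ℝ}
    (h : RegularEnvironment k q K C) {π : ℝ≥0 → ℝ≥0} (hπ : Measurable π) {W : ℝ≥0 → ℝ}
    (hW : Measurable W) {c : ℝ} (hc : ∀ s, |W s| ≤ c) (hstep : ∀ s, W s ≤ policyStep M k q π W s)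
    (s : ℝ≥0) : W s ≤ expectedPayoff M k q π s := by
  choose B hB using exists_abs_expectedGain_le M h hπ
  have hm := measurable_expectedGain M q h.monotone_reward hπ
  have key : ∀ (N : ℕ) (s : ℝ≥0), W s ≤ ∑ i ∈ Finset.range N, expectedGain M k q π i s +
      c * discount M q ^ N := by
    intro N
    induction N with
    | zero => intro s; simpa using (abs_le.1 (hc s)).2
    | succ N ih =>
      intro s
      rw [sum_expectedGain_succ M h hπ, pow_succ, ← mul_assoc]
      have := policyStep_le_add M h hπ hW (Finset.measurable_sum _ fun i _ => hm i)
        hc (c' := ∑ i ∈ Finset.range N, B i) (fun y => (Finset.abs_sum_le_sum_abs _ _).trans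
          (Finset.sum_le_sum fun i _ => hB i y)) ih s
      linarith [hstep s]
  have ht := (integrable_payoff_and_hasSum M h hπ s).2.tendsto_sum_nat.add
    ((tendsto_pow_atTop_nhds_zero_of_lt_one (discount_nonneg M q)
      (discount_lt_one M q)).const_mul c)
  rw [mul_zero, add_zero] at ht
  exact ge_of_tendsto' ht fun N => key N s

/-! ### The Bellman operator -/

open Classical in
/-- The value of an auction taking place at age `y`, won exactly when this is profitable, given the
continuation value `W`. -/
def bellmanContinuation (k : ℝ → ℝ) (W : ℝ≥0 → ℝ) (y : ℝ≥0) (p : EReal) : ℝ :=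
  if p = ⊤ then W y else max (W y) (k y - p.toReal + W 0)

/-- The Bellman operator. -/
def bellmanStep (M : AuctionModel) (k q : ℝ → ℝ) (W : ℝ≥0 → ℝ) (s : ℝ≥0) : ℝ :=
  ∫ a, Real.exp (-(M.endRate * a.1)) * bellmanContinuation k W (s + a.1.toNNReal) a.2.1
    ∂auctionLaw M q

/-- The greedy policy of a continuation value `W`. -/
def greedyPolicy (k : ℝ → ℝ) (W : ℝ≥0 → ℝ) (y : ℝ≥0) : ℝ≥0 := Real.toNNReal (k y + W 0 - W y)

/-- Clipping the bid at `0` is harmless because prices are nonnegative and a win requires a strict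
inequality. The condition `p ≠ ⊤` is needed because `EReal.toReal ⊤ = 0` would make an unbeatable
price look free. -/
theorem lt_greedyPolicy_iff {k : ℝ → ℝ} {W : ℝ≥0 → ℝ} {y : ℝ≥0} {p : EReal} (hp : 0 ≤ p) :
    p < ((greedyPolicy k W y : ℝ) : EReal) ↔ p ≠ ⊤ ∧ W y < k y - p.toReal + W 0 := by
  induction p with
  | bot => simp at hp
  | top => simp
  | coe p =>
    have hp' : 0 ≤ p := by exact_mod_cast hp
    rw [EReal.coe_lt_coe_iff, greedyPolicy, Real.coe_toNNReal', lt_max_iff, EReal.toReal_coe]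
    simp only [ne_eq, EReal.coe_ne_top, not_false_eq_true, true_and]
    constructor
    · rintro (h | h) <;> linarith
    · intro h; left; linarith

/-- The greedy bid wins exactly when winning is strictly better; at a tie both options have the same
value. -/
theorem continuation_greedyPolicy {k : ℝ → ℝ} {W : ℝ≥0 → ℝ} {y : ℝ≥0} {p : EReal} (hp : 0 ≤ p) :
    continuation k (greedyPolicy k W) W y p = bellmanContinuation k W y p := by
  unfold continuation bellmanContinuation
  simp only [lt_greedyPolicy_iff hp]
  by_cases h : p = ⊤
  · simp [h]
  · by_cases h' : W y < k y - p.toReal + W 0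
    · simp [h, h', h'.le]
    · simp [h, h', not_lt.1 h']

theorem continuation_le_bellmanContinuation (k : ℝ → ℝ) (π : ℝ≥0 → ℝ≥0) (W : ℝ≥0 → ℝ) (y : ℝ≥0)
    (p : EReal) : continuation k π W y p ≤ bellmanContinuation k W y p := by
  unfold continuation bellmanContinuation
  split_ifs with h1 h2
  · simp [h2] at h1
  · exact le_max_right _ _
  · exact le_rfl
  · exact le_max_left _ _

theorem bellmanContinuation_mono {k : ℝ → ℝ} {W W' : ℝ≥0 → ℝ} (h : ∀ y, W y ≤ W' y) (y : ℝ≥0)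
    (p : EReal) : bellmanContinuation k W y p ≤ bellmanContinuation k W' y p := by
  unfold bellmanContinuation
  split_ifs
  · exact h y
  · exact max_le_max (h y) (by linarith [h 0])

theorem bellmanContinuation_nonneg {k : ℝ → ℝ} {W : ℝ≥0 → ℝ} (h : ∀ y, 0 ≤ W y) (y : ℝ≥0)
    (p : EReal) : 0 ≤ bellmanContinuation k W y p := by
  unfold bellmanContinuation
  split_ifs
  · exact h y
  · exact (h y).trans (le_max_left _ _)

theorem bellmanContinuation_le {k : ℝ → ℝ} {W : ℝ≥0 → ℝ} {K B : ℝ} (hk : ∀ y : ℝ≥0, |k y| ≤ K)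
    (hB : ∀ y, W y ≤ B) (y : ℝ≥0) {p : EReal} (hp : 0 ≤ p) :
    bellmanContinuation k W y p ≤ B + K := by
  have h1 := hk y
  have h2 := hB y
  have h3 := hB 0
  have h4 := EReal.toReal_nonneg hp
  have h5 := (abs_nonneg _).trans h1
  have h6 := (abs_le.1 h1).2
  unfold bellmanContinuation
  split_ifs
  · linarith
  · exact max_le (by linarith) (by linarith)

/-- From `y` to `y'` winning gains exactly `k y' - k y` and losing gains at most that, so the
maximum gains at most that too. -/
theorem bellmanContinuation_sub_le {k : ℝ → ℝ} {W : ℝ≥0 → ℝ} {y y' : ℝ≥0}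
    (h : k y - W y ≤ k y' - W y') (p : EReal) :
    bellmanContinuation k W y' p - bellmanContinuation k W y p ≤ k y' - k y := by
  unfold bellmanContinuation
  split_ifs
  · linarith
  · rw [sub_le_iff_le_add]
    refine max_le ?_ ?_
    · linarith [le_max_left (W y) (k y - p.toReal + W 0)]
    · linarith [le_max_right (W y) (k y - p.toReal + W 0)]

theorem measurable_bellmanContinuation {k : ℝ → ℝ} (hk : Monotone fun y : ℝ≥0 => k y)
    {W : ℝ≥0 → ℝ} (hW : Measurable W) (s : ℝ≥0) :
    Measurable fun a : AuctionData => bellmanContinuation k W (s + a.1.toNNReal) a.2.1 := by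
  unfold bellmanContinuation
  have hy : Measurable fun a : AuctionData => s + a.1.toNNReal := by fun_prop
  have hp : Measurable fun a : AuctionData => a.2.1 := by fun_prop
  refine Measurable.ite (hp (measurableSet_singleton ⊤)) (hW.comp hy) ?_
  exact (hW.comp hy).max (((hk.measurable.comp hy).sub
    (measurable_ereal_toReal.comp hp)).add_const _)

section

variable {M : AuctionModel} {k q : ℝ → ℝ} {K C : ℝ} {W : ℝ≥0 → ℝ} {B : ℝ}

theorem integrable_bellmanContinuation (h : RegularEnvironment k q K C) (hW : Measurable W)
    (h0 : ∀ y, 0 ≤ W y) (hB : ∀ y, W y ≤ B) (s : ℝ≥0) :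
    Integrable (fun a => Real.exp (-(M.endRate * a.1)) *
      bellmanContinuation k W (s + a.1.toNNReal) a.2.1) (auctionLaw M q) := by
  refine integrable_exp_mul M q (measurable_bellmanContinuation h.monotone_reward hW s)
    (c := B + K) ?_
  filter_upwards [ae_price_mem M h] with a ha
  rw [abs_of_nonneg (bellmanContinuation_nonneg h0 _ _)]
  exact bellmanContinuation_le h.abs_reward_le hB _ ha.1

theorem bellmanStep_nonneg (h0 : ∀ y, 0 ≤ W y) (s : ℝ≥0) : 0 ≤ bellmanStep M k q W s :=
  integral_nonneg fun _ => mul_nonneg (Real.exp_pos _).le (bellmanContinuation_nonneg h0 _ _)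

theorem bellmanStep_le (h : RegularEnvironment k q K C) (hW : Measurable W)
    (h0 : ∀ y, 0 ≤ W y) (hB : ∀ y, W y ≤ B) (s : ℝ≥0) :
    bellmanStep M k q W s ≤ discount M q * (B + K) := by
  rw [discount, ← integral_mul_const]
  refine integral_mono_ae (integrable_bellmanContinuation h hW h0 hB s)
    ((integrable_exp_gap M q).mul_const _) ?_
  filter_upwards [ae_price_mem M h] with a ha
  exact mul_le_mul_of_nonneg_left (bellmanContinuation_le h.abs_reward_le hB _ ha.1)
    (Real.exp_pos _).le

theorem bellmanStep_mono (h : RegularEnvironment k q K C) (hW : Measurable W)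
    (h0 : ∀ y, 0 ≤ W y) {W' : ℝ≥0 → ℝ} (hW' : Measurable W') (hB : ∀ y, W' y ≤ B)
    (hle : ∀ y, W y ≤ W' y) (s : ℝ≥0) : bellmanStep M k q W s ≤ bellmanStep M k q W' s := by
  refine integral_mono (integrable_bellmanContinuation h hW h0 (fun y => (hle y).trans (hB y)) s)
    (integrable_bellmanContinuation h hW' (fun y => (h0 y).trans (hle y)) hB s) fun a => ?_
  exact mul_le_mul_of_nonneg_left (bellmanContinuation_mono hle _ _) (Real.exp_pos _).le

/-- `W` is the difference of the monotone functions `k` and `k - W`, so the monotonicity invariant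
also supplies measurability. -/
theorem measurable_of_monotone_sub (hk : Monotone fun y : ℝ≥0 => k y)
    (hD : Monotone fun y : ℝ≥0 => k y - W y) : Measurable W := by
  have := hk.measurable.sub hD.measurable
  simpa [Pi.sub_def] using this

/-- The Bellman operator preserves the continuation values `W` such that `k - W` is
nondecreasing. -/
theorem monotone_sub_bellmanStep (h : RegularEnvironment k q K C)
    (hD : Monotone fun y : ℝ≥0 => k y - W y) (h0 : ∀ y, 0 ≤ W y) (hB : ∀ y, W y ≤ B) :
    Monotone fun y : ℝ≥0 => k y - bellmanStep M k q W y := by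
  intro s s' hs
  have hW := measurable_of_monotone_sub h.monotone_reward hD
  have i1 := integrable_bellmanContinuation (M := M) h hW h0 hB s
  have i2 := integrable_bellmanContinuation (M := M) h hW h0 hB s'
  have hkk : 0 ≤ k s' - k s := sub_nonneg.2 (h.monotone_reward hs)
  have : bellmanStep M k q W s' - bellmanStep M k q W s ≤ k s' - k s := by
    rw [bellmanStep, bellmanStep, ← integral_sub i2 i1]
    have hc : ∫ _, (k s' - k s) ∂auctionLaw M q = k s' - k s := by simp
    rw [← hc]
    refine integral_mono_ae (i2.sub i1) (integrable_const _) ?_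
    filter_upwards [ae_exp_le_one M q] with a ha
    -- The two ages are compared after the same gap: the reward increment shrinks by concavity, and
    -- the discount shrinks it further because it is nonnegative.
    have hy : s + a.1.toNNReal ≤ s' + a.1.toNNReal := by gcongr
    have h1 := bellmanContinuation_sub_le (W := W) (k := k) (hD hy) a.2.1
    have h2 := h.increments_le s s' a.1.toNNReal hs
    rw [← mul_sub]
    exact (mul_le_mul_of_nonneg_left (h1.trans h2) (Real.exp_pos _).le).trans
      (mul_le_of_le_one_left hkk ha)
  linarith

/-- The Bellman equation has a bounded nonnegative solution `W` such that `k - W` is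
nondecreasing. -/
theorem exists_bellman_fixedPoint (M : AuctionModel) (h : RegularEnvironment k q K C) :
    ∃ (W : ℝ≥0 → ℝ) (B : ℝ), (∀ s, 0 ≤ W s) ∧ (∀ s, W s ≤ B) ∧
      (Monotone fun y : ℝ≥0 => k y - W y) ∧ ∀ s, bellmanStep M k q W s = W s := by
  have hK : 0 ≤ K := (abs_nonneg _).trans (h.abs_reward_le 0)
  have hδ : 0 < 1 - discount M q := by linarith [discount_lt_one M q]
  -- `B` solves `discount * (B + K) = B`, so `bellmanStep_le` keeps all iterates below it.
  set B := discount M q * K / (1 - discount M q) with hBdef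
  have hB0 : 0 ≤ B := div_nonneg (mul_nonneg (discount_nonneg M q) hK) hδ.le
  have hBB : discount M q * (B + K) = B := by
    rw [hBdef]
    field_simp
    ring
  set u : ℕ → ℝ≥0 → ℝ := fun n => (bellmanStep M k q)^[n] 0 with hu
  have hsucc : ∀ n, u (n + 1) = bellmanStep M k q (u n) := fun n =>
    Function.iterate_succ_apply' _ _ _
  have key : ∀ n, (∀ s, 0 ≤ u n s) ∧ (∀ s, u n s ≤ B) ∧
      Monotone fun y : ℝ≥0 => k y - u n y := by
    intro n
    induction n with
    | zero =>
      refine ⟨fun s => le_rfl, fun s => hB0, ?_⟩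
      simpa [hu] using h.monotone_reward
    | succ n ih =>
      rw [hsucc]
      have hm := measurable_of_monotone_sub h.monotone_reward ih.2.2
      exact ⟨bellmanStep_nonneg ih.1, fun s => (bellmanStep_le h hm ih.1 ih.2.1 s).trans_eq hBB,
        monotone_sub_bellmanStep h ih.2.2 ih.1 ih.2.1⟩
  have hm : ∀ n, Measurable (u n) := fun n =>
    measurable_of_monotone_sub h.monotone_reward (key n).2.2
  have hle : ∀ n s, u n s ≤ u (n + 1) s := by
    intro n
    induction n with
    | zero => exact (key 1).1
    | succ n ih =>
      intro s
      rw [hsucc (n + 1), hsucc n, ← hsucc n]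
      conv_lhs => rw [hsucc n]
      exact bellmanStep_mono h (hm n) (key n).1 (hm (n + 1)) (key (n + 1)).2.1 ih s
  set W : ℝ≥0 → ℝ := fun s => ⨆ n, u n s with hWdef
  have hlim : ∀ s, Tendsto (fun n => u n s) atTop (𝓝 (W s)) := fun s =>
    tendsto_atTop_ciSup (monotone_nat_of_le_succ fun n => hle n s)
      ⟨B, by rintro _ ⟨n, rfl⟩; exact (key n).2.1 s⟩
  refine ⟨W, B, fun s => ge_of_tendsto' (hlim s) fun n => (key n).1 s,
    fun s => le_of_tendsto' (hlim s) fun n => (key n).2.1 s, fun y y' hy =>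
      le_of_tendsto_of_tendsto' ((hlim y).const_sub _) ((hlim y').const_sub _)
        fun n => (key n).2.2 hy, fun s => ?_⟩
  have h1 : Tendsto (fun n => bellmanStep M k q (u n) s) atTop (𝓝 (W s)) := by
    simpa only [hsucc] using (tendsto_add_atTop_iff_nat 1).2 (hlim s)
  refine tendsto_nhds_unique ?_ h1
  -- Bounded convergence passes the limit through the operator, whose integrand is continuous in the
  -- values of `W`.
  refine tendsto_integral_filter_of_norm_le_const (Eventually.of_forall fun n =>
    (integrable_bellmanContinuation h (hm n) (key n).1 (key n).2.1 s).aestronglyMeasurable)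
    ⟨B + K, Eventually.of_forall fun n => ?_⟩ (Eventually.of_forall fun a => ?_)
  · filter_upwards [ae_price_mem M h, ae_exp_le_one M q] with a ha he
    have hnn := bellmanContinuation_nonneg (k := k) (key n).1 (s + a.1.toNNReal) a.2.1
    rw [Real.norm_of_nonneg (mul_nonneg (Real.exp_pos _).le hnn)]
    exact (mul_le_of_le_one_left hnn he).trans
      (bellmanContinuation_le h.abs_reward_le (key n).2.1 _ ha.1)
  · refine Tendsto.const_mul _ ?_
    unfold bellmanContinuation
    split_ifs
    · exact hlim _
    · exact (hlim _).max ((hlim 0).const_add _)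

/-- Verification: a bounded solution of the Bellman equation is the Bellman value, and the solver
returns an optimal policy. -/
theorem verification (h : RegularEnvironment k q K C) (hW : Measurable W)
    (h0 : ∀ s, 0 ≤ W s) (hB : ∀ s, W s ≤ B) (hfix : ∀ s, bellmanStep M k q W s = W s) :
    solver M k q = greedyPolicy k W ∧ IsOptimal M k q (solver M k q) ∧
      ∀ s, expectedPayoff M k q (solver M k q) s = W s := by
  have habs : ∀ s, |W s| ≤ B := fun s => by rw [abs_of_nonneg (h0 s)]; exact hB s
  have hg : Measurable (greedyPolicy k W) :=
    ((h.monotone_reward.measurable.add_const _).sub hW).real_toNNReal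
  have hle : ∀ (π : ℝ≥0 → ℝ≥0), Measurable π → ∀ s, expectedPayoff M k q π s ≤ W s := by
    intro π hπ s
    refine expectedPayoff_le_of_policyStep_le M h hπ hW habs (fun s => ?_) s
    rw [← hfix s]
    exact integral_mono (integrable_continuation M h hπ hW habs s)
      (integrable_bellmanContinuation h hW h0 hB s) fun a =>
        mul_le_mul_of_nonneg_left (continuation_le_bellmanContinuation k π W _ _) (Real.exp_pos _).le
  have heq : ∀ s, expectedPayoff M k q (greedyPolicy k W) s = W s := by
    intro s
    refine le_antisymm (hle _ hg s)
      (le_expectedPayoff_of_le_policyStep M h hg hW habs (fun s => ?_) s)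
    conv_lhs => rw [← hfix s]
    refine le_of_eq (integral_congr_ae ?_)
    filter_upwards [ae_price_mem M h] with a ha
    rw [continuation_greedyPolicy ha.1]
  have hV : bellmanValue M k q = W := by
    funext s
    have : Nonempty Policy := ⟨⟨_, hg⟩⟩
    refine le_antisymm (ciSup_le fun π => hle π.1 π.2 s) ?_
    rw [← heq s]
    exact le_ciSup (f := fun π : Policy => expectedPayoff M k q π.1 s)
      ⟨W s, by rintro _ ⟨π, rfl⟩; exact hle π.1 π.2 s⟩ ⟨_, hg⟩
  have hsol : solver M k q = greedyPolicy k W := by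
    funext s
    rw [solver, hV, greedyPolicy]
  rw [hsol]
  refine ⟨rfl, ⟨hg, fun s => ⟨(integrable_payoff_and_hasSum M h hg s).1, fun ρ =>
    ⟨(integrable_payoff_and_hasSum M h ρ.2 s).1, ?_⟩⟩⟩, heq⟩
  rw [heq s]
  exact hle ρ.1 ρ.2 s

end

/-! ### Regularity of the classes of rewards and competitions -/

/-- Both `s'` and `s + x` are convex combinations of `s` and `s' + x`, with exchanged weights;
adding the two concavity inequalities gives the claim. -/
theorem ConcaveOn.increments_le {k : ℝ → ℝ} (hk : ConcaveOn ℝ (Ici 0) k) {s s' x : ℝ}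
    (hs : 0 ≤ s) (hss : s ≤ s') (hx : 0 ≤ x) : k (s' + x) - k (s + x) ≤ k s' - k s := by
  rcases hss.eq_or_lt with rfl | hlt
  · simp
  have hd : 0 < s' - s + x := by linarith
  have hy : s' + x ∈ Ici (0 : ℝ) := show (0 : ℝ) ≤ s' + x by linarith
  have ha : 0 ≤ x / (s' - s + x) := div_nonneg hx hd.le
  have hb : 0 ≤ (s' - s) / (s' - s + x) := div_nonneg (by linarith) hd.le
  have e3 : x / (s' - s + x) + (s' - s) / (s' - s + x) = 1 := by field_simp; ring
  have h1 := hk.2 (show s ∈ Ici (0 : ℝ) from hs) hy ha hb e3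
  have h2 := hk.2 (show s ∈ Ici (0 : ℝ) from hs) hy hb ha (by rw [add_comm, e3])
  have e1 : (x / (s' - s + x)) • s + ((s' - s) / (s' - s + x)) • (s' + x) = s' := by
    simp only [smul_eq_mul]; field_simp; ring
  have e2 : ((s' - s) / (s' - s + x)) • s + (x / (s' - s + x)) • (s' + x) = s + x := by
    simp only [smul_eq_mul]; field_simp; ring
  rw [e1] at h1
  rw [e2] at h2
  simp only [smul_eq_mul] at h1 h2
  have e4 : x / (s' - s + x) = 1 - (s' - s) / (s' - s + x) := by linarith
  rw [e4] at h1 h2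
  linarith

theorem quantile_nonneg (q : ℝ → ℝ) (u : ℝ) : 0 ≤ quantile q u :=
  le_iInf fun _ => le_iInf fun hb => by exact_mod_cast hb.1

theorem quantile_le_of_le {q : ℝ → ℝ} {u x : ℝ} (hx : 0 ≤ x) (hu : u ≤ q x) :
    quantile q u ≤ x := iInf₂_le x ⟨hx, hu⟩

/-- Beyond the last breakpoint `q` is affine and at most `1`, so it cannot increase: every level it
reaches is already reached at that breakpoint. -/
theorem exists_forall_quantile_toReal_le {n : ℕ} {b : Fin (n + 1) → ℝ} (hb : StrictMono b)
    (hb0 : b 0 = 0) {q : ℝ → ℝ} (hq : q ∈ CompetitionClass b) :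
    ∃ C : ℝ, ∀ u, (quantile q u).toReal ≤ C := by
  obtain ⟨⟨-, m, c, hmc⟩, hmono, -, h1⟩ := hq
  set L := b (Fin.last n)
  have hL : 0 ≤ L := hb0 ▸ hb.monotone (Fin.zero_le _)
  have hm : m ≤ 0 := by
    by_contra hm
    push Not at hm
    -- At this point a line of positive slope `m` would have value at least `2`.
    have hx : L ≤ L + (|1 - m * L - c| + 1) / m := by
      have : 0 ≤ (|1 - m * L - c| + 1) / m := by positivity
      linarith
    have h := h1 _ (show (0 : ℝ) ≤ _ from hL.trans hx)
    rw [hmc _ hx, mul_add, mul_div_cancel₀ _ hm.ne'] at h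
    linarith [le_abs_self (1 - m * L - c)]
  refine ⟨L, fun u => ?_⟩
  by_cases h : ∃ x, 0 ≤ x ∧ u ≤ q x
  · obtain ⟨x, hx, hu⟩ := h
    have hle : quantile q u ≤ (L : EReal) := by
      refine quantile_le_of_le hL ?_
      rcases le_total x L with hxL | hxL
      · exact hu.trans (hmono hx hL hxL)
      · rw [hmc x hxL] at hu
        rw [hmc L self_mem_Ici]
        nlinarith
    have := EReal.toReal_le_toReal hle
      (ne_of_gt (lt_of_lt_of_le EReal.bot_lt_zero (quantile_nonneg q u))) (EReal.coe_ne_top L)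
    simpa using this
  -- A level never reached has an infinite price, whose `toReal` is `0`.
  · have : quantile q u = ⊤ := by
      refine top_unique (le_iInf₂ fun x hx => absurd ⟨x, hx⟩ h)
    simpa [this] using hL

theorem exists_regularEnvironment {m n : ℕ} {t : Fin (m + 1) → ℝ} (ht : StrictMono t)
    (ht0 : t 0 = 0) {b : Fin (n + 1) → ℝ} (hb : StrictMono b) (hb0 : b 0 = 0) {k q : ℝ → ℝ}
    (hk : k ∈ RewardClass t) (hq : q ∈ CompetitionClass b) :
    ∃ K C, RegularEnvironment k q K C := by
  obtain ⟨-, hconc, hmono, hconst⟩ := hk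
  obtain ⟨C, hC⟩ := exists_forall_quantile_toReal_le hb hb0 hq
  set T := t (Fin.last m)
  have hT : 0 ≤ T := ht0 ▸ ht.monotone (Fin.zero_le _)
  refine ⟨max |k 0| |k T|, C, fun y y' h => hmono y.2 y'.2 h, fun y => ?_,
    fun s s' x h => ?_, ?_⟩
  · have h0 : k 0 ≤ k y := hmono self_mem_Ici y.2 y.2
    have h1 : k y ≤ k T := by
      rcases le_total (y : ℝ) T with hy | hy
      · exact hmono y.2 hT hy
      · exact (hconst y hy).le
    exact abs_le_max_abs_abs h0 h1
  · simpa using ConcaveOn.increments_le hconc s.2 h x.2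
  · rw [priceLaw, ae_map_iff (measurable_quantile q).aemeasurable]
    · exact Eventually.of_forall fun u => ⟨quantile_nonneg q u, hC u⟩
    · exact measurableSet_Ici.inter (measurable_ereal_toReal measurableSet_Iic)

/-! ### Dependence on the competition -/

/-- A quantile below `β` is approached by points of `[0, β]` where `q₁` reaches the level `u`, and
there `q₂` reaches it too. -/
theorem quantile_le_quantile_of_eqOn {q₁ q₂ : ℝ → ℝ} {β u : ℝ} (h : ∀ x ∈ Icc 0 β, q₂ x = q₁ x)
    (hu : quantile q₁ u < β) : quantile q₂ u ≤ quantile q₁ u := by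
  by_contra hlt
  push Not at hlt
  have hmin : quantile q₁ u < min (quantile q₂ u) β := lt_min hlt hu
  unfold quantile at hmin
  simp only [iInf_lt_iff] at hmin
  obtain ⟨x, ⟨hx, hux⟩, hxlt⟩ := hmin
  obtain ⟨h1, h2⟩ := lt_min_iff.1 hxlt
  have hxβ : x ≤ β := by exact_mod_cast h2.le
  exact absurd (quantile_le_of_le hx (hux.trans_eq (h x ⟨hx, hxβ⟩).symm)) (not_le.2 h1)

theorem quantile_eq_or_of_eqOn {q₁ q₂ : ℝ → ℝ} {β : ℝ} (h : ∀ x ∈ Icc 0 β, q₂ x = q₁ x) (u : ℝ) :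
    quantile q₁ u = quantile q₂ u ∨ β ≤ quantile q₁ u ∧ β ≤ quantile q₂ u := by
  have h' : ∀ x ∈ Icc 0 β, q₁ x = q₂ x := fun x hx => (h x hx).symm
  rcases lt_or_ge (quantile q₁ u) β with h1 | h1
  · have h2 := quantile_le_quantile_of_eqOn h h1
    exact .inl ((quantile_le_quantile_of_eqOn h' (h2.trans_lt h1)).antisymm h2)
  · rcases lt_or_ge (quantile q₂ u) β with h2 | h2
    · have h3 := quantile_le_quantile_of_eqOn h' h2
      exact absurd (h3.trans_lt h2) (not_lt.2 h1)
    · exact .inr ⟨h1, h2⟩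

theorem bellmanContinuation_of_le {k : ℝ → ℝ} {W : ℝ≥0 → ℝ} {y : ℝ≥0} {β : ℝ}
    (hz : k y + W 0 - W y ≤ β) {p : EReal} (hp : β ≤ p) : bellmanContinuation k W y p = W y := by
  unfold bellmanContinuation
  split_ifs with h
  · rfl
  · have : β ≤ p.toReal := by
      simpa using EReal.toReal_le_toReal hp (EReal.coe_ne_bot β) h
    exact max_eq_left (by linarith)

/-- This moves the dependence on `q` from the measure to the integrand, so two competitions can be
compared pointwise at the same uniform variable. -/
theorem bellmanStep_eq_integral_quantile (M : AuctionModel) {k : ℝ → ℝ} (q : ℝ → ℝ)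
    (hk : Monotone fun y : ℝ≥0 => k y) {W : ℝ≥0 → ℝ} (hW : Measurable W) (s : ℝ≥0) :
    bellmanStep M k q W s = ∫ z : ℝ × ℝ × ℝ, Real.exp (-(M.endRate * z.1)) *
      bellmanContinuation k W (s + z.1.toNNReal) (quantile q z.2.1)
        ∂(expMeasure M.arrivalRate).prod ((volume.restrict (Icc (0 : ℝ) 1)).prod M.seedLaw) := by
  have := isProbabilityMeasure_expMeasure M.arrivalRate_pos
  have := M.seedLaw_prob
  have hq := measurable_quantile q
  have hmap : auctionLaw M q = ((expMeasure M.arrivalRate).prod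
      ((volume.restrict (Icc (0 : ℝ) 1)).prod M.seedLaw)).map
        (Prod.map id (Prod.map (quantile q) id)) := by
    rw [← Measure.map_prod_map _ _ measurable_id (hq.prodMap measurable_id),
      ← Measure.map_prod_map _ _ hq measurable_id, Measure.map_id, Measure.map_id]
    rfl
  have hm := measurable_bellmanContinuation hk hW s
  rw [bellmanStep, hmap, integral_map (measurable_id.prodMap (hq.prodMap measurable_id)).aemeasurable
    (by fun_prop)]
  rfl

/-- The Bellman operator only depends on the competition up to the maximal greedy bid. -/
theorem bellmanStep_congr (M : AuctionModel) {k q₁ q₂ : ℝ → ℝ}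
    (hk : Monotone fun y : ℝ≥0 => k y) {W : ℝ≥0 → ℝ} (hW : Measurable W) {β : ℝ}
    (hβ : ∀ y : ℝ≥0, k y + W 0 - W y ≤ β) (h : ∀ x ∈ Icc 0 β, q₂ x = q₁ x) (s : ℝ≥0) :
    bellmanStep M k q₁ W s = bellmanStep M k q₂ W s := by
  rw [bellmanStep_eq_integral_quantile M q₁ hk hW, bellmanStep_eq_integral_quantile M q₂ hk hW]
  congr 1
  funext z
  rcases quantile_eq_or_of_eqOn h z.2.1 with he | ⟨h1, h2⟩
  · rw [he]
  · rw [bellmanContinuation_of_le (hβ _) h1, bellmanContinuation_of_le (hβ _) h2]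

end DynamicBidding

end

/-! ### Extension invariance -/

theorem mainTheorem2 (M : DynamicBidding.AuctionModel)
    {m n : ℕ} (t : Fin (m + 1) → ℝ) (ht : StrictMono t) (ht0 : t 0 = 0)
    (b : Fin (n + 1) → ℝ) (hb : StrictMono b) (hb0 : b 0 = 0)
    (k : ℝ → ℝ) (hk : k ∈ DynamicBidding.RewardClass t)
    (q₁ q₂ : ℝ → ℝ) (hq₁ : q₁ ∈ DynamicBidding.CompetitionClass b)
    (hq₂ : q₂ ∈ DynamicBidding.CompetitionClass b) :
    -- the solver returns optimal policies
    DynamicBidding.IsOptimal M k q₁ (DynamicBidding.solver M k q₁) ∧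
    DynamicBidding.IsOptimal M k q₂ (DynamicBidding.solver M k q₂) ∧
    -- the bid of the optimal policy converges, and its limit is the maximal optimal bid
    Tendsto (DynamicBidding.solver M k q₁) atTop
      (𝓝 (DynamicBidding.asymptoticBid (DynamicBidding.solver M k q₁))) ∧
    (∀ τ : ℝ≥0, DynamicBidding.solver M k q₁ τ ≤
      DynamicBidding.asymptoticBid (DynamicBidding.solver M k q₁)) ∧
    -- extension invariance
    ((∀ x ∈ Icc (0 : ℝ) (DynamicBidding.asymptoticBid (DynamicBidding.solver M k q₁)),
        q₂ x = q₁ x) →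
      DynamicBidding.expectedPayoff M k q₁ (DynamicBidding.solver M k q₁) 0 =
          DynamicBidding.expectedPayoff M k q₂ (DynamicBidding.solver M k q₂) 0 ∧
        DynamicBidding.solver M k q₁ = DynamicBidding.solver M k q₂) := by
  open DynamicBidding in
  obtain ⟨K, C₁, h₁⟩ := exists_regularEnvironment ht ht0 hb hb0 hk hq₁
  obtain ⟨K₂, C₂, h₂⟩ := exists_regularEnvironment ht ht0 hb hb0 hk hq₂
  obtain ⟨W, B, hW0, hWB, hD, hfix⟩ := exists_bellman_fixedPoint M h₁
  obtain ⟨W₂, B₂, hW0₂, hWB₂, hD₂, hfix₂⟩ := exists_bellman_fixedPoint M h₂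
  have hW := measurable_of_monotone_sub h₁.monotone_reward hD
  obtain ⟨hsol, hopt, hval⟩ := verification h₁ hW hW0 hWB hfix
  have hopt₂ := (verification h₂ (measurable_of_monotone_sub h₂.monotone_reward hD₂)
    hW0₂ hWB₂ hfix₂).2.1
  have hmono : Monotone (solver M k q₁) := by
    rw [hsol]
    refine fun y y' hy => Real.toNNReal_le_toNNReal ?_
    have := hD hy
    simp only at this
    linarith
  have hbdd : BddAbove (range (solver M k q₁)) := by
    refine ⟨(K + B).toNNReal, ?_⟩
    rintro _ ⟨y, rfl⟩
    rw [hsol]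
    refine Real.toNNReal_le_toNNReal ?_
    linarith [(abs_le.1 (h₁.abs_reward_le y)).2, hWB 0, hW0 y]
  have hlim := tendsto_atTop_ciSup hmono hbdd
  have hasym : asymptoticBid (solver M k q₁) = ⨆ y, solver M k q₁ y := hlim.limUnder_eq
  have hle : ∀ τ, solver M k q₁ τ ≤ asymptoticBid (solver M k q₁) := fun τ => by
    rw [hasym]
    exact le_ciSup hbdd τ
  refine ⟨hopt, hopt₂, by rwa [hasym], hle, fun heq => ?_⟩
  -- The unclipped bid is at most its positive part, hence at most the limit.
  have hz : ∀ y : ℝ≥0, k y + W 0 - W y ≤ (asymptoticBid (solver M k q₁) : ℝ) := fun y => by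
    have h := hle y
    nth_rewrite 1 [hsol] at h
    exact (Real.le_coe_toNNReal _).trans (NNReal.coe_le_coe.2 h)
  -- The fixed point `W` built for `q₁` is verified in the environment of `q₂`; no comparison with
  -- `W₂` is needed.
  obtain ⟨hsol', -, hval'⟩ := verification h₂ hW hW0 hWB fun s => by
    rw [← bellmanStep_congr M h₁.monotone_reward hW hz heq s, hfix s]
  exact ⟨by rw [hval, hval'], by rw [hsol, hsol']⟩
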